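/- **Conventions.** A dcpo is a partially ordered set in which every (nonempty) directed subset has a supremum; maps between dcpos are called continuous if they preserve directed suprema, and $Y^X$ is the dcpo of continuous maps $X\to Y$ with the pointwise order. A dcpo $X$ is continuous if every $y\in X$ is the directed supremum of $\{x : x\ll y\}$, where $\ll$ is the way-below relation. A dcpo-algebra is a dcpo $A$ with a continuous binary operation (no laws required); $\mathsf{hom}(A,B)$ is the dcpo of continuous homomorphisms, ordered pointwise; a subalgebra is a subset closed under the operation and under directed suprema; powers $A^X$ carry the pointwise operation. A dcpo-meet-semilattice is a dcpo-algebra whose operation is the binary greatest lower bound; $\Sigma_\wedge$ is the chain $\{0<1\}$ with $\min$. Fix a dcpo-algebra $R$. For a dcpo-algebra $C$, a continuous homomorphism $e\colon A\to B$ of dcpo-algebras is $C$-equable if $h\mapsto h\circ e$, $\mathsf{hom}(B,C)\to\mathsf{hom}(A,C)$, is an isomorphism of dcpos, and a continuous map $e\colon Y\to A$ from a dcpo to a dcpo-algebra is $C$-equable if $h\mapsto h\circ e$, $\mathsf{hom}(A,C)\to C^Y$, is an isomorphism of dcpos. $C$ is $R$-complete (weakly $R$-complete) if every $R$-equable homomorphism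 of dcpo-algebras (every $R$-equable map from a dcpo to a dcpo-algebra) is $C$-equable. The $R$-repletion of a dcpo-algebra $A$ is the intersection $R(A)$ of all $R$-complete subalgebras of $R^{\mathsf{hom}(A,R)}$ containing all evaluations $h\mapsto h(a)$, $a\in A$, with reflection map $a\mapsto(h\mapsto h(a))$. The $R$-repletion of a dcpo $X$ is $R(X):=R(F(X))$, where $F(X)\supseteq X$ is the free dcpo-algebra over $X$, with the reflection map $r_X\colon X\to R(X)$ obtained by restriction to $X$. **Theorem.** Let $X$ be a continuous dcpo. Let $\mathsf{hom}_{0,1}(\Sigma_\wedge^X,\Sigma_\wedge)\subseteq\Sigma_\wedge^{\Sigma_\wedge^X}$ be the set of all continuous semilattice homomorphisms $\Sigma_\wedge^X\to\Sigma_\wedge$ that preserve bottom and top, and let $\eta_X(x)=(u\mapsto u(x))$ for $x\in X$. 1. $\mathsf{hom}_{0,1}(\Sigma_\wedge^X,\Sigma_\wedge)$ is a dcpo-meet-semilattice and is the $\Sigma_\wedge$-repletion of $X$: it is the least $\Sigma_\wedge$-complete, and also the least weakly $\Sigma_\wedge$-complete, subalgebra of $\Sigma_\wedge^{\Sigma_\wedge^X}$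 that contains all $\eta_X(x)$, $x\in X$; and there is an isomorphism of dcpo-algebras $\mathsf{hom}_{0,1}(\Sigma_\wedge^X,\Sigma_\wedge)\cong\Sigma_\wedge(X)$ that carries $\eta_X$ to the reflection map $r_X$. 2. Let $\mathcal S(X)$ be the set of nonempty subsets of $X$ that are compact and saturated in the Scott topology, ordered by reverse inclusion, with binary union as operation, and let $\eta^S_X(x)={\uparrow}x$. Then $\eta_X^S\colon X\to\mathcal S(X)$ is the Smyth powerdomain over $X$, that is, the free dcpo-meet-semilattice over $X$, and there is an isomorphism of dcpo-algebras $\mathcal S(X)\cong\Sigma_\wedge(X)$ that carries $\eta^S_X$ to $r_X$. -/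

import Mathlib

universe u v w

namespace DomainRepletion

/-! ### Dcpos and Scott-continuous maps -/

/-- A dcpo: every directed family (directed sets are nonempty) has a supremum. -/
class IsDcpo (X : Type u) [PartialOrder X] : Prop where
  exists_isLUB : ∀ D : Set X, D.Nonempty → DirectedOn (· ≤ ·) D → ∃ s, IsLUB D s

/-- The way-below relation `x ≪ y`. -/
def WayBelow {X : Type u} [PartialOrder X] (x y : X) : Prop :=
  ∀ D : Set X, D.Nonempty → DirectedOn (· ≤ ·) D → ∀ s, IsLUB D s → y ≤ s → ∃ d ∈ D, x ≤ d

/-- A continuous dcpo: every element is the directed supremum of the elements way below it. -/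
class IsContinuousDcpo (X : Type u) [PartialOrder X] : Prop extends IsDcpo X where
  nonempty_wayBelow : ∀ y : X, {x | WayBelow x y}.Nonempty
  directedOn_wayBelow : ∀ y : X, DirectedOn (· ≤ ·) {x | WayBelow x y}
  isLUB_wayBelow : ∀ y : X, IsLUB {x | WayBelow x y} y

/-- The exponential `Y ^ X`: Scott-continuous maps with the pointwise order. -/
@[ext]
structure ScottMap (X : Type u) (Y : Type v) [PartialOrder X] [PartialOrder Y] where
  toFun : X → Y
  continuous : ScottContinuous toFun

namespace ScottMap

variable {X : Type u} {Y : Type v} [PartialOrder X] [PartialOrder Y]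

instance : CoeFun (ScottMap X Y) (fun _ => X → Y) := ⟨ScottMap.toFun⟩

instance : PartialOrder (ScottMap X Y) :=
  PartialOrder.lift ScottMap.toFun (fun _ _ h => ScottMap.ext h)

theorem le_def {f g : ScottMap X Y} : f ≤ g ↔ ∀ x, f x ≤ g x := Iff.rfl

end ScottMap

/-- If the values of a family of Scott-continuous functions have suprema pointwise, then the
pointwise supremum is Scott-continuous. -/
theorem scottContinuous_of_pointwise_isLUB {X : Type u} {Y : Type v} [PartialOrder X]
    [PartialOrder Y] {D : Set (X → Y)} (hD : ∀ f ∈ D, ScottContinuous f) {g : X → Y}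
    (hg : ∀ x, IsLUB ((fun f : X → Y => f x) '' D) (g x)) : ScottContinuous g := by
  intro E hE hE' a ha
  constructor
  · rintro _ ⟨x, hx, rfl⟩
    refine (hg x).2 ?_
    rintro _ ⟨f, hf, rfl⟩
    exact ((hD f hf).monotone (ha.1 hx)).trans ((hg a).1 ⟨f, hf, rfl⟩)
  · intro b hb
    refine (hg a).2 ?_
    rintro _ ⟨f, hf, rfl⟩
    refine (hD f hf hE hE' ha).2 ?_
    rintro _ ⟨x, hx, rfl⟩
    exact ((hg x).1 ⟨f, hf, rfl⟩).trans (hb ⟨x, hx, rfl⟩)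

theorem ScottMap.isLUB_of_pointwise {X : Type u} {Y : Type v} [PartialOrder X] [PartialOrder Y]
    {D : Set (ScottMap X Y)} {g : ScottMap X Y}
    (hg : ∀ x, IsLUB ((fun f : ScottMap X Y => f x) '' D) (g x)) : IsLUB D g := by
  constructor
  · intro f hf x
    exact (hg x).1 ⟨f, hf, rfl⟩
  · intro h hh x
    refine (hg x).2 ?_
    rintro _ ⟨f, hf, rfl⟩
    exact hh hf x

theorem ScottMap.exists_pointwise_isLUB {X : Type u} {Y : Type v} [PartialOrder X]
    [PartialOrder Y] [IsDcpo Y] {D : Set (ScottMap X Y)} (hD : D.Nonempty)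
    (hD' : DirectedOn (· ≤ ·) D) :
    ∃ g : ScottMap X Y, ∀ x, IsLUB ((fun f : ScottMap X Y => f x) '' D) (g x) := by
  have h : ∀ x : X, ∃ s, IsLUB ((fun f : ScottMap X Y => f x) '' D) s := by
    intro x
    refine IsDcpo.exists_isLUB _ (hD.image _) ?_
    rintro _ ⟨f, hf, rfl⟩ _ ⟨f', hf', rfl⟩
    obtain ⟨k, hk, h1, h2⟩ := hD' f hf f' hf'
    exact ⟨_, ⟨k, hk, rfl⟩, h1 x, h2 x⟩
  choose g hg using h
  refine ⟨⟨g, ?_⟩, hg⟩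
  refine scottContinuous_of_pointwise_isLUB (D := ScottMap.toFun '' D) ?_ ?_
  · rintro _ ⟨f, _, rfl⟩
    exact f.continuous
  · intro x
    rw [Set.image_image]
    exact hg x

/-- Directed suprema in `Y ^ X` are computed pointwise. -/
theorem ScottMap.pointwise_of_isLUB {X : Type u} {Y : Type v} [PartialOrder X]
    [PartialOrder Y] [IsDcpo Y] {D : Set (ScottMap X Y)} (hD : D.Nonempty)
    (hD' : DirectedOn (· ≤ ·) D) {g : ScottMap X Y} (hg : IsLUB D g) (x : X) :
    IsLUB ((fun f : ScottMap X Y => f x) '' D) (g x) := by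
  obtain ⟨k, hk⟩ := ScottMap.exists_pointwise_isLUB hD hD'
  rw [hg.unique (ScottMap.isLUB_of_pointwise hk)]
  exact hk x

instance {X : Type u} {Y : Type v} [PartialOrder X] [PartialOrder Y] [IsDcpo Y] :
    IsDcpo (ScottMap X Y) where
  exists_isLUB _ hD hD' :=
    (ScottMap.exists_pointwise_isLUB hD hD').imp fun _ h => ScottMap.isLUB_of_pointwise h

/-! ### Dcpo-algebras for the signature with one binary operation symbol -/

/-- An interpretation of the single binary operation symbol. -/
class BinOp (A : Type u) where
  op : A → A → A

infixl:65 " ⋓ " => BinOp.op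

/-- A dcpo-algebra: a dcpo with a Scott-continuous binary operation. No laws are required. -/
class DcpoAlgebra (A : Type u) [PartialOrder A] [BinOp A] : Prop extends IsDcpo A where
  op_continuous : ScottContinuous (fun p : A × A => p.1 ⋓ p.2)

/-- A dcpo-meet-semilattice: a dcpo-algebra whose operation is the binary greatest lower bound. -/
class DcpoMeetSemilattice (A : Type u) [PartialOrder A] [BinOp A] : Prop
    extends DcpoAlgebra A where
  op_isGLB : ∀ a b : A, IsGLB {a, b} (a ⋓ b)

theorem op_mono {A : Type u} [PartialOrder A] [BinOp A] [DcpoAlgebra A] {a b c d : A}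
    (h : a ≤ c) (h' : b ≤ d) : a ⋓ b ≤ c ⋓ d :=
  (DcpoAlgebra.op_continuous (A := A)).monotone (show (a, b) ≤ (c, d) from ⟨h, h'⟩)

/-- The underlying object of the power algebra `A ^ X` carries the pointwise operation. -/
instance {X : Type u} {A : Type v} [PartialOrder X] [PartialOrder A] [BinOp A] [DcpoAlgebra A] :
    BinOp (ScottMap X A) where
  op f g := ⟨fun x => f x ⋓ g x,
    ScottContinuous.comp (g := fun p : A × A => p.1 ⋓ p.2) (f := fun x => (f x, g x))
      (f.continuous.prodMk g.continuous) DcpoAlgebra.op_continuous⟩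

theorem directedOn_image_of_monotone {A : Type u} {B : Type v} [PartialOrder A] [PartialOrder B]
    {D : Set A} (hD : DirectedOn (· ≤ ·) D) {f : A → B} (hf : Monotone f) :
    DirectedOn (· ≤ ·) (f '' D) := by
  rintro _ ⟨a, ha, rfl⟩ _ ⟨b, hb, rfl⟩
  obtain ⟨c, hc, h1, h2⟩ := hD a ha b hb
  exact ⟨_, ⟨c, hc, rfl⟩, hf h1, hf h2⟩

instance {X : Type u} {A : Type v} [PartialOrder X] [PartialOrder A] [BinOp A] [DcpoAlgebra A] :
    DcpoAlgebra (ScottMap X A) where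
  op_continuous := by
    intro D hD hD' a ha
    refine ScottMap.isLUB_of_pointwise fun x => ?_
    rw [isLUB_prod] at ha
    have h1 := ScottMap.pointwise_of_isLUB (hD.image _)
      (directedOn_image_of_monotone hD' monotone_fst) ha.1 x
    have h2 := ScottMap.pointwise_of_isLUB (hD.image _)
      (directedOn_image_of_monotone hD' monotone_snd) ha.2 x
    have hm : Monotone (fun p : ScottMap X A × ScottMap X A => (p.1 x, p.2 x)) :=
      fun p q h => ⟨h.1 x, h.2 x⟩
    have h3 : IsLUB ((fun p : ScottMap X A × ScottMap X A => (p.1 x, p.2 x)) '' D)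
        (a.1 x, a.2 x) := by
      rw [isLUB_prod]
      rw [Set.image_image] at h1 h2 ⊢
      rw [Set.image_image]
      exact ⟨h1, h2⟩
    have h4 := DcpoAlgebra.op_continuous (A := A) (hD.image _)
      (directedOn_image_of_monotone hD' hm) h3
    rw [Set.image_image] at h4 ⊢
    exact h4

/-- `hom(A, B)`: Scott-continuous homomorphisms, ordered pointwise. -/
@[ext]
structure Hom (A : Type u) (B : Type v) [PartialOrder A] [BinOp A] [PartialOrder B] [BinOp B] where
  toFun : A → B
  continuous : ScottContinuous toFun
  map_op : ∀ a b, toFun (a ⋓ b) = toFun a ⋓ toFun b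

namespace Hom

variable {A : Type u} {B : Type v} [PartialOrder A] [BinOp A] [PartialOrder B] [BinOp B]

instance : CoeFun (Hom A B) (fun _ => A → B) := ⟨Hom.toFun⟩

instance : PartialOrder (Hom A B) :=
  PartialOrder.lift Hom.toFun (fun _ _ h => Hom.ext h)

/-- Directed suprema in `hom(A, B)` are computed pointwise. -/
theorem pointwise_of_isLUB [DcpoAlgebra B] {D : Set (Hom A B)} (hD : D.Nonempty)
    (hD' : DirectedOn (· ≤ ·) D) {g : Hom A B} (hg : IsLUB D g) (x : A) :
    IsLUB ((fun f : Hom A B => f x) '' D) (g x) := by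
  have hm : ∀ x : A, Monotone (fun f : Hom A B => f x) := fun x _ _ h => h x
  have h : ∀ x : A, ∃ s, IsLUB ((fun f : Hom A B => f x) '' D) s := fun x =>
    IsDcpo.exists_isLUB _ (hD.image _) (directedOn_image_of_monotone hD' (hm x))
  choose k hk using h
  have hkc : ScottContinuous k := by
    refine scottContinuous_of_pointwise_isLUB (D := Hom.toFun '' D) ?_ ?_
    · rintro _ ⟨f, _, rfl⟩
      exact f.continuous
    · intro x
      rw [Set.image_image]
      exact hk x
  have hko : ∀ a b, k (a ⋓ b) = k a ⋓ k b := by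
    intro a b
    have hm2 : Monotone (fun f : Hom A B => (f a, f b)) := fun f g h => ⟨h a, h b⟩
    have h3 : IsLUB ((fun f : Hom A B => (f a, f b)) '' D) (k a, k b) := by
      rw [isLUB_prod, Set.image_image, Set.image_image]
      exact ⟨hk a, hk b⟩
    have h4 := DcpoAlgebra.op_continuous (A := B) (hD.image _)
      (directedOn_image_of_monotone hD' hm2) h3
    rw [Set.image_image] at h4
    refine (hk (a ⋓ b)).unique ?_
    have h5 : (fun f : Hom A B => f (a ⋓ b)) = fun f : Hom A B => f a ⋓ f b :=
      funext fun f => f.map_op a b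
    rw [h5]
    exact h4
  have hl : IsLUB D (⟨k, hkc, hko⟩ : Hom A B) := by
    constructor
    · intro f hf x
      exact (hk x).1 ⟨f, hf, rfl⟩
    · intro f hf x
      refine (hk x).2 ?_
      rintro _ ⟨f', hf', rfl⟩
      exact hf hf' x
  rw [hg.unique hl]
  exact hk x

end Hom

/-! ### Equability and completeness -/

/-- A homomorphism `e : A → B` is `C`-equable if restriction along `e`,
`hom(B, C) → hom(A, C)`, `h ↦ h ∘ e`, is an isomorphism of dcpos. -/
def Equable {A : Type u} {B : Type v} (C : Type w) [PartialOrder A] [BinOp A]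
    [PartialOrder B] [BinOp B] [PartialOrder C] [BinOp C] (e : Hom A B) : Prop :=
  ∃ φ : Hom B C ≃o Hom A C, ∀ (h : Hom B C) (a : A), φ h a = h (e a)

/-- A Scott-continuous map `e : Y → A` from a dcpo to an algebra is `C`-equable if restriction
along `e`, `hom(A, C) → C ^ Y`, `h ↦ h ∘ e`, is an isomorphism of dcpos. -/
def EquableMap {Y : Type u} {A : Type v} (C : Type w) [PartialOrder Y] [PartialOrder A] [BinOp A]
    [PartialOrder C] [BinOp C] (e : ScottMap Y A) : Prop :=
  ∃ φ : Hom A C ≃o ScottMap Y C, ∀ (h : Hom A C) (y : Y), φ h y = h (e y)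

/-- `C` is `R`-complete: every `R`-equable homomorphism of dcpo-algebras is `C`-equable. -/
def IsComplete (R : Type v) [PartialOrder R] [BinOp R] (C : Type w) [PartialOrder C] [BinOp C] :
    Prop :=
  ∀ (A B : Type w) [PartialOrder A] [BinOp A] [DcpoAlgebra A]
    [PartialOrder B] [BinOp B] [DcpoAlgebra B] (e : Hom A B), Equable R e → Equable C e

/-- `C` is weakly `R`-complete: every `R`-equable map from a dcpo to a dcpo-algebra is
`C`-equable. -/
def IsWeaklyComplete (R : Type v) [PartialOrder R] [BinOp R]
    (C : Type w) [PartialOrder C] [BinOp C] : Prop :=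
  ∀ (Y A : Type w) [PartialOrder Y] [IsDcpo Y] [PartialOrder A] [BinOp A] [DcpoAlgebra A]
    (e : ScottMap Y A), EquableMap R e → EquableMap C e

/-! ### Subalgebras -/

/-- A dcpo-subalgebra: a subset closed under the operation and under directed suprema. -/
@[ext]
structure SubAlg (A : Type u) [PartialOrder A] [BinOp A] where
  carrier : Set A
  op_mem : ∀ a ∈ carrier, ∀ b ∈ carrier, a ⋓ b ∈ carrier
  sup_mem : ∀ D ⊆ carrier, D.Nonempty → DirectedOn (· ≤ ·) D → ∀ s, IsLUB D s → s ∈ carrier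

namespace SubAlg

variable {A : Type u} [PartialOrder A] [BinOp A]

instance : Membership A (SubAlg A) := ⟨fun T a => a ∈ T.carrier⟩

instance : CoeSort (SubAlg A) (Type u) := ⟨fun T => {a : A // a ∈ T}⟩

/-- Subalgebras are ordered by inclusion. -/
instance : PartialOrder (SubAlg A) :=
  PartialOrder.lift SubAlg.carrier (fun _ _ h => SubAlg.ext h)

instance (T : SubAlg A) : BinOp T := ⟨fun a b => ⟨a.1 ⋓ b.1, T.op_mem _ a.2 _ b.2⟩⟩

theorem isLUB_of_val {T : SubAlg A} {D : Set T} {s : T} (h : IsLUB (Subtype.val '' D) s.1) :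
    IsLUB D s := by
  constructor
  · intro d hd
    exact h.1 ⟨d, hd, rfl⟩
  · intro b hb
    refine h.2 ?_
    rintro _ ⟨d, hd, rfl⟩
    exact hb hd

theorem exists_isLUB_val [IsDcpo A] {T : SubAlg A} {D : Set T} (hD : D.Nonempty)
    (hD' : DirectedOn (· ≤ ·) D) : ∃ s : T, IsLUB (Subtype.val '' D) s.1 := by
  have hd := directedOn_image_of_monotone hD' (f := (Subtype.val : T → A)) (fun _ _ h => h)
  obtain ⟨s, hs⟩ := IsDcpo.exists_isLUB _ (hD.image _) hd
  refine ⟨⟨s, T.sup_mem _ ?_ (hD.image _) hd s hs⟩, hs⟩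
  rintro _ ⟨d, _, rfl⟩
  exact d.2

theorem isLUB_val [IsDcpo A] {T : SubAlg A} {D : Set T} (hD : D.Nonempty)
    (hD' : DirectedOn (· ≤ ·) D) {s : T} (hs : IsLUB D s) : IsLUB (Subtype.val '' D) s.1 := by
  obtain ⟨t, ht⟩ := exists_isLUB_val hD hD'
  rw [hs.unique (isLUB_of_val ht)]
  exact ht

instance [DcpoAlgebra A] (T : SubAlg A) : DcpoAlgebra T where
  exists_isLUB _ hD hD' := (exists_isLUB_val hD hD').imp fun _ h => isLUB_of_val h
  op_continuous := by
    intro D hD hD' a ha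
    refine isLUB_of_val ?_
    rw [isLUB_prod] at ha
    have h1 := isLUB_val (hD.image _) (directedOn_image_of_monotone hD' monotone_fst) ha.1
    have h2 := isLUB_val (hD.image _) (directedOn_image_of_monotone hD' monotone_snd) ha.2
    have hm : Monotone (fun p : T × T => (p.1.1, p.2.1)) := fun p q h => ⟨h.1, h.2⟩
    have h3 : IsLUB ((fun p : T × T => (p.1.1, p.2.1)) '' D) (a.1.1, a.2.1) := by
      rw [isLUB_prod]
      rw [Set.image_image] at h1 h2 ⊢
      rw [Set.image_image]
      exact ⟨h1, h2⟩
    have h4 := DcpoAlgebra.op_continuous (A := A) (hD.image _)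
      (directedOn_image_of_monotone hD' hm) h3
    rw [Set.image_image] at h4 ⊢
    exact h4

end SubAlg

/-! ### Repletion -/

section Repletion

variable (R : Type v) [PartialOrder R] [BinOp R] [DcpoAlgebra R]

/-- The evaluation `η_X(x) = (f ↦ f(x)) ∈ R ^ (R ^ X)` of a dcpo `X`. -/
def evalMap {X : Type u} [PartialOrder X] (x : X) : ScottMap (ScottMap X R) R :=
  ⟨fun f => f x, fun _ hD hD' _ ha => ScottMap.pointwise_of_isLUB hD hD' ha x⟩

/-- The evaluation `η_A(a) = (h ↦ h(a)) ∈ R ^ hom(A, R)` of a dcpo-algebra `A`. -/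
def evalHom {A : Type u} [PartialOrder A] [BinOp A] (a : A) : ScottMap (Hom A R) R :=
  ⟨fun h => h a, fun _ hD hD' _ ha => Hom.pointwise_of_isLUB hD hD' ha a⟩

/-- The `R`-repletion of a dcpo-algebra `A`: the intersection of all `R`-complete subalgebras of
`R ^ hom(A, R)` that contain the image of `A` under evaluation. -/
def repletion (A : Type u) [PartialOrder A] [BinOp A] : SubAlg (ScottMap (Hom A R) R) where
  carrier := {f | ∀ T : SubAlg (ScottMap (Hom A R) R),
    IsComplete R T → (∀ a : A, evalHom R a ∈ T) → f ∈ T}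
  op_mem f hf g hg T hT hT' := T.op_mem f (hf T hT hT') g (hg T hT hT')
  sup_mem D hD hD1 hD2 s hs T hT hT' :=
    T.sup_mem D (fun _ hd => hD hd T hT hT') hD1 hD2 s hs

/-- The reflection map `A → R(A)`, the corestriction of the evaluation. -/
def reflectionMap {A : Type u} [PartialOrder A] [BinOp A] (a : A) : repletion R A :=
  ⟨evalHom R a, fun _ _ h => h a⟩

end Repletion

/-! ### The free dcpo-algebra over a dcpo -/

/-- The order on binary trees with leaves in `X`: equal shapes and leafwise comparison. -/
def freeLE {X : Type u} [PartialOrder X] : FreeMagma X → FreeMagma X → Prop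
  | .of x, .of y => x ≤ y
  | .mul a b, .mul c d => freeLE a c ∧ freeLE b d
  | .of _, .mul _ _ => False
  | .mul _ _, .of _ => False

section FreeAlgebra

variable {X : Type u} [PartialOrder X]

theorem freeLE_refl (a : FreeMagma X) : freeLE a a := by
  induction a using FreeMagma.rec with
  | of x => exact le_refl x
  | mul a b iha ihb => exact ⟨iha, ihb⟩

theorem freeLE_trans : ∀ a b c : FreeMagma X, freeLE a b → freeLE b c → freeLE a c
  | .of _, .of _, .of _, h, h' => le_trans (α := X) h h'
  | .mul a a', .mul b b', .mul c c', h, h' =>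
    ⟨freeLE_trans a b c h.1 h'.1, freeLE_trans a' b' c' h.2 h'.2⟩

theorem freeLE_antisymm : ∀ a b : FreeMagma X, freeLE a b → freeLE b a → a = b
  | .of _, .of _, h, h' => congrArg FreeMagma.of (le_antisymm (α := X) h h')
  | .mul a a', .mul b b', h, h' => by
    rw [freeLE_antisymm a b h.1 h'.1, freeLE_antisymm a' b' h.2 h'.2]

instance : PartialOrder (FreeMagma X) where
  le := freeLE
  le_refl := freeLE_refl
  le_trans := freeLE_trans
  le_antisymm := freeLE_antisymm

instance : BinOp (FreeMagma X) := ⟨FreeMagma.mul⟩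

theorem free_exists_isLUB [IsDcpo X] (t : FreeMagma X) : ∀ D : Set (FreeMagma X), t ∈ D →
    DirectedOn (· ≤ ·) D → ∃ s, IsLUB D s := by
  induction t using FreeMagma.rec with
  | of x =>
    intro D ht hD
    have hof : ∀ d ∈ D, ∃ y, d = FreeMagma.of y := by
      intro d hd
      obtain ⟨c, _, h1, h2⟩ := hD _ ht d hd
      match c, d, h1, h2 with
      | .of _, .of y, _, _ => exact ⟨y, rfl⟩
    have hdir : DirectedOn (· ≤ ·) (FreeMagma.of ⁻¹' D) := by
      intro y hy z hz
      obtain ⟨c, hc, h1, h2⟩ := hD _ hy _ hz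
      obtain ⟨k, rfl⟩ := hof c hc
      exact ⟨k, hc, h1, h2⟩
    obtain ⟨s, hs⟩ := IsDcpo.exists_isLUB _ ⟨x, ht⟩ hdir
    refine ⟨FreeMagma.of s, ?_, ?_⟩
    · intro d hd
      obtain ⟨y, rfl⟩ := hof d hd
      exact hs.1 hd
    · intro b hb
      have hxb := hb ht
      match b, hb, hxb with
      | .of b, hb, _ => exact hs.2 fun y hy => hb hy
  | mul a a' iha iha' =>
    intro D ht hD
    have hmul : ∀ d ∈ D, ∃ y z, d = FreeMagma.mul y z := by
      intro d hd
      obtain ⟨c, _, h1, h2⟩ := hD _ ht d hd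
      match c, d, h1, h2 with
      | .mul _ _, .mul y z, _, _ => exact ⟨y, z, rfl⟩
    obtain ⟨s, hs⟩ := iha {y | ∃ z, FreeMagma.mul y z ∈ D} ⟨a', ht⟩ (by
      rintro y ⟨z, hy⟩ y' ⟨z', hy'⟩
      obtain ⟨c, hc, h1, h2⟩ := hD _ hy _ hy'
      obtain ⟨k, l, rfl⟩ := hmul c hc
      exact ⟨k, ⟨l, hc⟩, h1.1, h2.1⟩)
    obtain ⟨s', hs'⟩ := iha' {z | ∃ y, FreeMagma.mul y z ∈ D} ⟨a, ht⟩ (by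
      rintro y ⟨z, hy⟩ y' ⟨z', hy'⟩
      obtain ⟨c, hc, h1, h2⟩ := hD _ hy _ hy'
      obtain ⟨k, l, rfl⟩ := hmul c hc
      exact ⟨l, ⟨k, hc⟩, h1.2, h2.2⟩)
    refine ⟨FreeMagma.mul s s', ?_, ?_⟩
    · intro d hd
      obtain ⟨y, z, rfl⟩ := hmul d hd
      exact ⟨hs.1 ⟨z, hd⟩, hs'.1 ⟨y, hd⟩⟩
    · intro b hb
      have hxb := hb ht
      match b, hb, hxb with
      | .mul b b', hb, _ =>
        exact ⟨hs.2 fun y hy => (hb hy.choose_spec).1, hs'.2 fun z hz => (hb hz.choose_spec).2⟩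

/-- The (absolutely) free dcpo-algebra over a dcpo `X`: binary trees with leaves in `X`. -/
instance [IsDcpo X] : DcpoAlgebra (FreeMagma X) where
  exists_isLUB D hD hD' := free_exists_isLUB hD.some D hD.some_mem hD'
  op_continuous := by
    intro D hD _ a ha
    rw [isLUB_prod] at ha
    constructor
    · rintro _ ⟨p, hp, rfl⟩
      exact ⟨ha.1.1 ⟨p, hp, rfl⟩, ha.2.1 ⟨p, hp, rfl⟩⟩
    · intro b hb
      have h0 := hb ⟨hD.some, hD.some_mem, rfl⟩
      match b, hb, h0 with
      | .mul b b', hb, _ =>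
        refine ⟨ha.1.2 ?_, ha.2.2 ?_⟩
        · rintro _ ⟨p, hp, rfl⟩
          exact (hb ⟨p, hp, rfl⟩).1
        · rintro _ ⟨p, hp, rfl⟩
          exact (hb ⟨p, hp, rfl⟩).2

/-- The homomorphic extension of a map to trees. -/
def freeLift {A : Type v} [BinOp A] (f : X → A) : FreeMagma X → A
  | .of x => f x
  | .mul a b => freeLift f a ⋓ freeLift f b

theorem freeLift_continuous {A : Type v} [PartialOrder A] [BinOp A] [DcpoAlgebra A] {f : X → A}
    (hf : ScottContinuous f) : ScottContinuous (freeLift f) := by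
  have hmono : ∀ a b : FreeMagma X, freeLE a b → freeLift f a ≤ freeLift f b := by
    intro a
    induction a using FreeMagma.rec with
    | of x =>
      intro b h
      match b, h with
      | .of y, h => exact hf.monotone h
    | mul a a' iha iha' =>
      intro b h
      match b, h with
      | .mul b b', h => exact op_mono (iha b h.1) (iha' b' h.2)
  suffices H : ∀ (a : FreeMagma X) (D : Set (FreeMagma X)), D.Nonempty →
      DirectedOn (· ≤ ·) D → IsLUB D a → IsLUB (freeLift f '' D) (freeLift f a) from
    fun D hD hD' a ha => H a D hD hD' ha
  intro a
  induction a using FreeMagma.rec with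
  | of x =>
    intro D hD hD' ha
    have hof : ∀ d ∈ D, ∃ y, d = FreeMagma.of y := by
      intro d hd
      have h := ha.1 hd
      match d, h with
      | .of y, _ => exact ⟨y, rfl⟩
    have himg : FreeMagma.of '' (FreeMagma.of ⁻¹' D) = D := by
      refine Set.image_preimage_eq_of_subset fun d hd => ?_
      obtain ⟨y, rfl⟩ := hof d hd
      exact ⟨y, rfl⟩
    have h := hf (d := FreeMagma.of ⁻¹' D) (by
      obtain ⟨d, hd⟩ := hD
      obtain ⟨y, rfl⟩ := hof d hd
      exact ⟨y, hd⟩) (by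
      intro y hy z hz
      obtain ⟨c, hc, h1, h2⟩ := hD' _ hy _ hz
      obtain ⟨k, rfl⟩ := hof c hc
      exact ⟨k, hc, h1, h2⟩) (a := x) ⟨fun y hy => ha.1 hy, fun y hy => ha.2 (show FreeMagma.of y ∈ upperBounds D by
      intro d hd
      obtain ⟨z, rfl⟩ := hof d hd
      exact hy hd)⟩
    rw [← himg, Set.image_image]
    exact h
  | mul a a' iha iha' =>
    intro D hD hD' ha
    have hmul : ∀ d ∈ D, ∃ y z, d = FreeMagma.mul y z := by
      intro d hd
      have h := ha.1 hd
      match d, h with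
      | .mul y z, _ => exact ⟨y, z, rfl⟩
    obtain ⟨d₀, hd₀⟩ := hD
    obtain ⟨y₀, z₀, rfl⟩ := hmul d₀ hd₀
    have h1 := iha {y | ∃ z, FreeMagma.mul y z ∈ D} ⟨y₀, z₀, hd₀⟩ (by
      rintro y ⟨z, hy⟩ y' ⟨z', hy'⟩
      obtain ⟨c, hc, h1, h2⟩ := hD' _ hy _ hy'
      obtain ⟨k, l, rfl⟩ := hmul c hc
      exact ⟨k, ⟨l, hc⟩, h1.1, h2.1⟩) ⟨fun y hy => (ha.1 hy.choose_spec).1, fun c hc =>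
        (ha.2 (show FreeMagma.mul c a' ∈ upperBounds D by
          intro d hd
          obtain ⟨y, z, rfl⟩ := hmul d hd
          exact ⟨hc ⟨z, hd⟩, (ha.1 hd).2⟩)).1⟩
    have h2 := iha' {z | ∃ y, FreeMagma.mul y z ∈ D} ⟨z₀, y₀, hd₀⟩ (by
      rintro y ⟨z, hy⟩ y' ⟨z', hy'⟩
      obtain ⟨c, hc, h1, h2⟩ := hD' _ hy _ hy'
      obtain ⟨k, l, rfl⟩ := hmul c hc
      exact ⟨l, ⟨k, hc⟩, h1.2, h2.2⟩) ⟨fun y hy => (ha.1 hy.choose_spec).2, fun c hc =>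
        (ha.2 (show FreeMagma.mul a c ∈ upperBounds D by
          intro d hd
          obtain ⟨y, z, rfl⟩ := hmul d hd
          exact ⟨(ha.1 hd).1, hc ⟨y, hd⟩⟩)).2⟩
    let P : Set (A × A) :=
      {p | ∃ y z, FreeMagma.mul y z ∈ D ∧ p = (freeLift f y, freeLift f z)}
    have hP : IsLUB P (freeLift f a, freeLift f a') := by
      rw [isLUB_prod]
      constructor
      · convert h1 using 1
        ext t
        constructor
        · rintro ⟨_, ⟨y, z, h, rfl⟩, rfl⟩
          exact ⟨y, ⟨z, h⟩, rfl⟩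
        · rintro ⟨y, ⟨z, h⟩, rfl⟩
          exact ⟨_, ⟨y, z, h, rfl⟩, rfl⟩
      · convert h2 using 1
        ext t
        constructor
        · rintro ⟨_, ⟨y, z, h, rfl⟩, rfl⟩
          exact ⟨z, ⟨y, h⟩, rfl⟩
        · rintro ⟨z, ⟨y, h⟩, rfl⟩
          exact ⟨_, ⟨y, z, h, rfl⟩, rfl⟩
    have h := DcpoAlgebra.op_continuous (A := A) (d := P) ⟨_, y₀, z₀, hd₀, rfl⟩ (by
      rintro _ ⟨y, z, hy, rfl⟩ _ ⟨y', z', hy', rfl⟩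
      obtain ⟨c, hc, h1, h2⟩ := hD' _ hy _ hy'
      obtain ⟨k, l, rfl⟩ := hmul c hc
      exact ⟨_, ⟨k, l, hc, rfl⟩, ⟨hmono _ _ h1.1, hmono _ _ h1.2⟩,
        ⟨hmono _ _ h2.1, hmono _ _ h2.2⟩⟩) hP
    change IsLUB _ (freeLift f a ⋓ freeLift f a')
    convert h using 1
    ext t
    constructor
    · rintro ⟨d, hd, rfl⟩
      obtain ⟨y, z, rfl⟩ := hmul d hd
      exact ⟨_, ⟨y, z, hd, rfl⟩, rfl⟩
    · rintro ⟨_, ⟨y, z, hd, rfl⟩, rfl⟩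
      exact ⟨_, hd, rfl⟩

/-- The inclusion of generators. -/
def freeOf : ScottMap X (FreeMagma X) where
  toFun := FreeMagma.of
  continuous := by
    intro D hD _ a ha
    constructor
    · rintro _ ⟨d, hd, rfl⟩
      exact ha.1 hd
    · intro b hb
      have h0 := hb ⟨hD.some, hD.some_mem, rfl⟩
      match b, hb, h0 with
      | .of b, hb, _ => exact ha.2 fun y hy => hb ⟨y, hy, rfl⟩

/-- Trees over `X` form the free dcpo-algebra: for every dcpo-algebra `A`, restriction to
generators is an isomorphism of dcpos from `hom(F(X), A)` to `A ^ X`. -/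
theorem equableMap_freeOf {A : Type v} [PartialOrder A] [BinOp A] [DcpoAlgebra A] :
    EquableMap A (freeOf : ScottMap X (FreeMagma X)) := by
  have key : ∀ h k : Hom (FreeMagma X) A, (∀ x, h (.of x) ≤ k (.of x)) → h ≤ k := by
    intro h k hk t
    induction t using FreeMagma.rec with
    | of x => exact hk x
    | mul a b iha ihb =>
      have e1 : h (.mul a b) = h a ⋓ h b := h.map_op a b
      have e2 : k (.mul a b) = k a ⋓ k b := k.map_op a b
      change h (.mul a b) ≤ k (.mul a b)
      rw [e1, e2]
      exact op_mono iha ihb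
  refine ⟨{ toFun := fun h => ⟨fun x => h (.of x), freeOf.continuous.comp h.continuous⟩
            invFun := fun f => ⟨freeLift f, freeLift_continuous f.continuous, fun _ _ => rfl⟩
            left_inv := fun h => le_antisymm (key _ _ fun _ => le_rfl) (key _ _ fun _ => le_rfl)
            right_inv := fun f => rfl
            map_rel_iff' := ⟨fun h => key _ _ h, fun h x => h _⟩ }, fun _ _ => rfl⟩

end FreeAlgebra

/-- The repletion of a dcpo `X`: the repletion of the free dcpo-algebra over `X`. -/
abbrev dcpoRepletion (R : Type v) [PartialOrder R] [BinOp R] [DcpoAlgebra R]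
    (X : Type u) [PartialOrder X] : SubAlg (ScottMap (Hom (FreeMagma X) R) R) :=
  repletion R (FreeMagma X)

/-- The reflection map of a dcpo `X` into its repletion. -/
def dcpoReflectionMap (R : Type v) [PartialOrder R] [BinOp R] [DcpoAlgebra R]
    {X : Type u} [PartialOrder X] (x : X) : dcpoRepletion R X :=
  reflectionMap R (freeOf x)

/-! ### The prototype: the two-element chain with binary meet -/

/-- The two-element chain `0 < 1`, realized as `False < True`. -/
abbrev Sierp : Type := Prop

/-- `min` on the two-element chain is conjunction. -/
instance : BinOp Sierp := ⟨And⟩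

instance : DcpoMeetSemilattice Sierp where
  exists_isLUB D _ _ := ⟨sSup D, isLUB_sSup D⟩
  op_continuous := by
    intro D _ hD' a ha
    rw [isLUB_prod] at ha
    constructor
    · rintro _ ⟨p, hp, rfl⟩ h
      exact ⟨ha.1.1 ⟨p, hp, rfl⟩ h.1, ha.2.1 ⟨p, hp, rfl⟩ h.2⟩
    · rintro b hb ⟨h1, h2⟩
      by_contra hc
      have e1 : ¬ ∀ p ∈ D, ¬ p.1 := fun h =>
        ha.1.2 (show False ∈ upperBounds (Prod.fst '' D) by
          rintro _ ⟨p, hp, rfl⟩ hh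
          exact h p hp hh) h1
      have e2 : ¬ ∀ p ∈ D, ¬ p.2 := fun h =>
        ha.2.2 (show False ∈ upperBounds (Prod.snd '' D) by
          rintro _ ⟨p, hp, rfl⟩ hh
          exact h p hp hh) h2
      push Not at e1 e2
      obtain ⟨p, hp, hp1⟩ := e1
      obtain ⟨q, hq, hq2⟩ := e2
      obtain ⟨r, hr, hpr, hqr⟩ := hD' p hp q hq
      exact hc (hb ⟨r, hr, rfl⟩ ⟨hpr.1 hp1, hqr.2 hq2⟩)
  op_isGLB a b := by
    constructor
    · rintro c (rfl | rfl) h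
      exacts [h.1, h.2]
    · intro c hc h
      exact ⟨hc (by simp) h, hc (by simp) h⟩

/-- The constant maps; these are the bottom and the top of the power of the two-element chain. -/
def constMap (X : Type u) [PartialOrder X] (b : Sierp) : ScottMap X Sierp :=
  ⟨fun _ => b, ScottContinuous.const b⟩

/-- `hom_{0,1}(Σ ^ X, Σ)` for the meet-semilattice `Σ` on the two-element chain: the Scott-continuous
semilattice homomorphisms `Σ ^ X → Σ` that preserve bottom and top, as a subalgebra of
`Σ ^ (Σ ^ X)`. -/
def homZeroOne (X : Type u) [PartialOrder X] : SubAlg (ScottMap (ScottMap X Sierp) Sierp) where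
  carrier := {φ | (∀ f g : ScottMap X Sierp, φ (f ⋓ g) = φ f ⋓ φ g) ∧
    φ (constMap X False) = False ∧ φ (constMap X True) = True}
  op_mem := by
    rintro φ ⟨h1, h2, h3⟩ ψ ⟨k1, k2, k3⟩
    refine ⟨fun f g => ?_, ?_, ?_⟩
    · change (φ (f ⋓ g) ∧ ψ (f ⋓ g)) = ((φ f ∧ ψ f) ∧ (φ g ∧ ψ g))
      rw [h1, k1]
      exact propext and_and_and_comm
    · change (φ _ ∧ ψ _) = _
      rw [h2, k2]
      simp
    · change (φ _ ∧ ψ _) = _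
      rw [h3, k3]
      simp
  sup_mem := by
    intro D hD hD1 hD2 s hs
    have hp := fun x => ScottMap.pointwise_of_isLUB hD1 hD2 hs x
    have key : ∀ f : ScottMap X Sierp, s f ↔ ∃ φ ∈ D, φ f := by
      intro f
      constructor
      · exact (hp f).2 (show (∃ φ ∈ D, φ f) ∈ upperBounds _ by
          rintro _ ⟨φ, hφ, rfl⟩ h
          exact ⟨φ, hφ, h⟩)
      · rintro ⟨φ, hφ, h⟩
        exact (hp f).1 ⟨φ, hφ, rfl⟩ h
    refine ⟨fun f g => propext ?_, propext ?_, propext ?_⟩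
    · change s (f ⋓ g) ↔ (s f ∧ s g)
      rw [key, key, key]
      constructor
      · rintro ⟨φ, hφ, h⟩
        rw [(hD hφ).1] at h
        exact ⟨⟨φ, hφ, h.1⟩, ⟨φ, hφ, h.2⟩⟩
      · rintro ⟨⟨φ, hφ, h⟩, ⟨ψ, hψ, h'⟩⟩
        obtain ⟨χ, hχ, h1, h2⟩ := hD2 φ hφ ψ hψ
        refine ⟨χ, hχ, ?_⟩
        rw [(hD hχ).1]
        exact ⟨h1 f h, h2 g h'⟩
    · rw [key]
      constructor
      · rintro ⟨φ, hφ, h⟩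
        rwa [(hD hφ).2.1] at h
      · exact False.elim
    · rw [key]
      refine ⟨fun _ => trivial, fun _ => ?_⟩
      obtain ⟨φ, hφ⟩ := hD1
      refine ⟨φ, hφ, ?_⟩
      rw [(hD hφ).2.2]
      trivial

/-- The evaluation `X → hom_{0,1}(Σ ^ X, Σ)`, `x ↦ (u ↦ u(x))`. -/
def homZeroOneEval {X : Type u} [PartialOrder X] (x : X) : homZeroOne X :=
  ⟨evalMap Sierp x, fun _ _ => rfl, rfl, rfl⟩

/-! ### The Smyth powerdomain -/

/-- The Scott topology. -/
abbrev scottTop (X : Type u) [PartialOrder X] : TopologicalSpace X := Topology.scott X Set.univ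

/-- Saturated: the intersection of all Scott-open sets containing the set. -/
def IsSaturated {X : Type u} [PartialOrder X] (Q : Set X) : Prop :=
  Q = ⋂₀ {U | @IsOpen X (scottTop X) U ∧ Q ⊆ U}

/-- The nonempty compact saturated subsets of `X` in the Scott topology. -/
@[ext]
structure Smyth (X : Type u) [PartialOrder X] where
  carrier : Set X
  nonempty : carrier.Nonempty
  compact : @IsCompact X (scottTop X) carrier
  saturated : IsSaturated carrier

namespace Smyth

variable {X : Type u} [PartialOrder X]

/-- The order is reverse inclusion. -/
instance : PartialOrder (Smyth X) :=
  PartialOrder.lift (fun Q => OrderDual.toDual Q.carrier) (fun _ _ h => Smyth.ext h)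

theorem le_def {P Q : Smyth X} : P ≤ Q ↔ Q.carrier ⊆ P.carrier := Iff.rfl

theorem isSaturated_union {P Q : Set X} (hP : IsSaturated P) (hQ : IsSaturated Q) :
    IsSaturated (P ∪ Q) := by
  refine Set.Subset.antisymm (fun x hx U hU => hU.2 hx) fun x hx => ?_
  by_contra hc
  rw [Set.mem_union, not_or, hP, hQ] at hc
  simp only [Set.mem_sInter, not_forall] at hc
  obtain ⟨⟨U, hU, hxU⟩, V, hV, hxV⟩ := hc
  let _ := scottTop X
  have := hx (U ∪ V) ⟨hU.1.union hV.1, Set.union_subset_union hU.2 hV.2⟩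
  exact this.elim hxU hxV

/-- The semilattice operation is binary union. -/
instance : BinOp (Smyth X) where
  op P Q := ⟨P.carrier ∪ Q.carrier, P.nonempty.inl,
    letI := scottTop X
    P.compact.union Q.compact, isSaturated_union P.saturated Q.saturated⟩

theorem isCompact_Ici (x : X) : @IsCompact X (scottTop X) (Set.Ici x) := by
  let _ := scottTop X
  have : Topology.IsScott X Set.univ := ⟨rfl⟩
  refine isCompact_of_finite_subcover fun {ι} U hU hc => ?_
  obtain ⟨i, hi⟩ := Set.mem_iUnion.1 (hc (Set.mem_Ici.2 (le_refl x)))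
  refine ⟨{i}, fun y hy => ?_⟩
  simpa using Topology.IsScott.isUpperSet_of_isOpen (D := Set.univ) (hU i) hy hi

theorem isSaturated_Ici (x : X) : IsSaturated (Set.Ici x) := by
  let _ := scottTop X
  have : Topology.IsScott X Set.univ := ⟨rfl⟩
  refine Set.Subset.antisymm (fun y hy U hU => hU.2 hy) fun y hy => ?_
  by_contra hc
  have := hy (Set.Iic y)ᶜ ⟨(isClosed_Iic (a := y)).isOpen_compl, fun z hz hzy => hc (le_trans hz hzy)⟩
  exact this (Set.mem_Iic.2 (le_refl y))

/-- The natural embedding `x ↦ ↑x`. -/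
def embed (x : X) : Smyth X :=
  ⟨Set.Ici x, ⟨x, le_refl x⟩, isCompact_Ici x, isSaturated_Ici x⟩

end Smyth

/-- `ι : X → F` exhibits `F` as the free dcpo-meet-semilattice over the dcpo `X`. -/
structure IsFreeDcpoMeetSemilattice {X F : Type u} [PartialOrder X] [PartialOrder F] [BinOp F]
    (ι : X → F) : Prop where
  semilattice : DcpoMeetSemilattice F
  continuous : ScottContinuous ι
  exists_unique_extension : ∀ (B : Type u) [PartialOrder B] [BinOp B] [DcpoMeetSemilattice B]
    (f : ScottMap X B), ∃! g : Hom F B, ∀ x, g (ι x) = f x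

end DomainRepletion

namespace DomainRepletion

/-! ### Scott-continuous maps into the two-element chain -/

section Sierp

variable {X : Type u} [PartialOrder X]

/-! A Scott-continuous map `X → Σ` is a Scott-open set, so an element of `hom_{0,1}(Σ ^ X, Σ)` is a
Scott-open filter of Scott-open sets, proper because bottom goes to bottom. Everything rests on
three facts about this algebra `H`.

Completeness (`isComplete_homZeroOne`): a homomorphism `A → H` is a family of homomorphisms `A → Σ`
indexed by open sets, subject to equations in the index (meets, bottom, top) and preservation of
directed suprema. Along a `Σ`-equable `e : A → B` each member extends uniquely to `B`, and
uniqueness carries the equations along, because constants and pointwise meets of homomorphisms into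
`Σ` are again homomorphisms. Weak completeness follows by replacing a map `Y → A` by its extension
to the free algebra (`equable_freeHom_iff`).

Generation (`homZeroOne.isLUB_freeLift`): over a continuous dcpo an open set is the directed union
of the sets `wayAbove t`, with `t` a tree whose leaves lie in it. Hence each filter is the directed
supremum of finite meets of evaluations. So `H` lies inside every subalgebra containing the
evaluations, which gives leastness for both notions of completeness. Transport along `hom(F(X), Σ)
≃o Σ ^ X` identifies `H` with the repletion. The same approximation makes `H` the free
dcpo-meet-semilattice (`homZeroOne.exists_extension`, `homZeroOne.hom_ext`).

Hofmann–Mislove (`homZeroOne.apply_of_forall`): a filter in `H` is determined by its intersection, a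
nonempty compact saturated set. This yields `smythIso`, through which freeness and the repletion
pass to the Smyth powerdomain. -/

theorem isLUB_sierp_iff {S : Set Sierp} {p : Sierp} : IsLUB S p ↔ (p ↔ ∃ q ∈ S, q) := by
  constructor
  · intro h
    refine ⟨h.2 (show (∃ q ∈ S, q) ∈ upperBounds S from fun q hq hq' => ⟨q, hq, hq'⟩), ?_⟩
    rintro ⟨q, hq, hq'⟩
    exact h.1 hq hq'
  · intro h
    refine ⟨fun q hq hq' => h.2 ⟨q, hq, hq'⟩, fun b hb hp => ?_⟩
    obtain ⟨q, hq, hq'⟩ := h.1 hp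
    exact hb hq hq'

theorem scottContinuous_sierp {f : X → Sierp} (hm : ∀ a b, a ≤ b → f a → f b)
    (h : ∀ D : Set X, D.Nonempty → DirectedOn (· ≤ ·) D → ∀ a, IsLUB D a → f a → ∃ d ∈ D, f d) :
    ScottContinuous f := by
  intro D hD hD' a ha
  refine isLUB_sierp_iff.2 ⟨fun hf => ?_, ?_⟩
  · obtain ⟨d, hd, hd'⟩ := h D hD hD' a ha hf
    exact ⟨_, ⟨d, hd, rfl⟩, hd'⟩
  · rintro ⟨_, ⟨d, hd, rfl⟩, hd'⟩
    exact hm d a (ha.1 hd) hd'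

theorem ScottMap.exists_apply_of_isLUB (f : ScottMap X Sierp) {D : Set X} (hD : D.Nonempty)
    (hD' : DirectedOn (· ≤ ·) D) {a : X} (ha : IsLUB D a) (h : f a) : ∃ d ∈ D, f d := by
  obtain ⟨_, ⟨d, hd, rfl⟩, hd'⟩ := (isLUB_sierp_iff.1 (f.continuous hD hD' ha)).1 h
  exact ⟨d, hd, hd'⟩

theorem ScottMap.apply_of_le (f : ScottMap X Sierp) {a b : X} (h : a ≤ b) (ha : f a) : f b :=
  f.continuous.monotone h ha

/-- The union of a family of Scott-open sets, as a map into the two-element chain. -/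
def supMap (S : Set (ScottMap X Sierp)) : ScottMap X Sierp :=
  ⟨fun x => ∃ f ∈ S, f x, scottContinuous_sierp
    (fun _ _ h ⟨f, hf, hfa⟩ => ⟨f, hf, f.apply_of_le h hfa⟩)
    (fun _ hD hD' _ ha ⟨f, hf, hfa⟩ =>
      (f.exists_apply_of_isLUB hD hD' ha hfa).imp fun _ hd => ⟨hd.1, f, hf, hd.2⟩)⟩

theorem isLUB_supMap (S : Set (ScottMap X Sierp)) : IsLUB S (supMap S) :=
  ⟨fun f hf _ hx => ⟨f, hf, hx⟩, fun _ hg _ ⟨_, hf, hx⟩ => hg hf _ hx⟩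

theorem ScottMap.exists_mem_of_isLUB {D : Set (ScottMap X Sierp)} (hD : D.Nonempty)
    (hD' : DirectedOn (· ≤ ·) D) {f : ScottMap X Sierp} (hf : IsLUB D f) {x : X} (hx : f x) :
    ∃ d ∈ D, d x := by
  obtain ⟨_, ⟨d, hd, rfl⟩, hd'⟩ :=
    (isLUB_sierp_iff.1 (ScottMap.pointwise_of_isLUB hD hD' hf x)).1 hx
  exact ⟨d, hd, hd'⟩

theorem ScottMap.isOpen_setOf (f : ScottMap X Sierp) : @IsOpen X (scottTop X) {x | f x} := by
  let _ := scottTop X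
  have : Topology.IsScott X Set.univ := ⟨rfl⟩
  exact Topology.IsScott.isOpen_iff_scottContinuous_mem.2 f.continuous

/-- A Scott-open set, as a map into the two-element chain. -/
def openMap (U : Set X) (hU : @IsOpen X (scottTop X) U) : ScottMap X Sierp :=
  ⟨fun x => x ∈ U, by
    let _ := scottTop X
    have : Topology.IsScott X Set.univ := ⟨rfl⟩
    exact Topology.IsScott.isOpen_iff_scottContinuous_mem.1 hU⟩

end Sierp

/-! ### Homomorphisms and isomorphisms -/

section Iso

theorem OrderIso.scottContinuous {A : Type u} {B : Type v} [PartialOrder A] [PartialOrder B]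
    (e : A ≃o B) : ScottContinuous e :=
  fun _ _ _ _ ha => e.isLUB_image'.2 ha

/-- Composition of homomorphisms. -/
def Hom.comp {A : Type*} {B : Type*} {C : Type*} [PartialOrder A] [BinOp A] [PartialOrder B]
    [BinOp B] [PartialOrder C] [BinOp C] (g : Hom B C) (f : Hom A B) : Hom A C :=
  ⟨fun a => g (f a), f.continuous.comp g.continuous, fun a b => by rw [f.map_op, g.map_op]⟩

/-- An order isomorphism that preserves the operation, as a homomorphism. -/
def Hom.ofIso {A : Type*} {B : Type*} [PartialOrder A] [BinOp A] [PartialOrder B] [BinOp B]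
    (e : A ≃o B) (he : ∀ a b, e (a ⋓ b) = e a ⋓ e b) : Hom A B :=
  ⟨e, OrderIso.scottContinuous e, he⟩

theorem symm_map_op {A : Type*} {B : Type*} [PartialOrder A] [BinOp A] [PartialOrder B] [BinOp B]
    {e : A ≃o B} (he : ∀ a b, e (a ⋓ b) = e a ⋓ e b) (a b : B) :
    e.symm (a ⋓ b) = e.symm a ⋓ e.symm b := by
  rw [e.symm_apply_eq, he, e.apply_symm_apply, e.apply_symm_apply]

/-- Isomorphic algebras admit the same homomorphisms into them. -/
def Hom.postcompIso (A : Type*) {C : Type*} {C' : Type*} [PartialOrder A] [BinOp A]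
    [PartialOrder C] [BinOp C] [PartialOrder C'] [BinOp C'] (e : C ≃o C')
    (he : ∀ a b, e (a ⋓ b) = e a ⋓ e b) : Hom A C ≃o Hom A C' where
  toFun := (Hom.ofIso e he).comp
  invFun := (Hom.ofIso e.symm (symm_map_op he)).comp
  left_inv h := Hom.ext (funext fun a => e.symm_apply_apply (h a))
  right_inv h := Hom.ext (funext fun a => e.apply_symm_apply (h a))
  map_rel_iff' {_ _} := forall_congr' fun _ => e.le_iff_le

theorem IsComplete.of_iso {R : Type v} [PartialOrder R] [BinOp R] {C : Type w} {C' : Type w}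
    [PartialOrder C] [BinOp C] [PartialOrder C'] [BinOp C'] (hC : IsComplete R C) (e : C ≃o C')
    (he : ∀ a b, e (a ⋓ b) = e a ⋓ e b) : IsComplete R C' := by
  intro A B _ _ _ _ _ _ i hi
  obtain ⟨φ, hφ⟩ := hC A B i hi
  refine ⟨((Hom.postcompIso B e he).symm.trans φ).trans (Hom.postcompIso A e he), fun h a => ?_⟩
  change e (φ _ a) = _
  rw [hφ]
  exact e.apply_symm_apply (h (i a))

theorem DcpoMeetSemilattice.of_iso {A : Type u} {B : Type v} [PartialOrder A] [BinOp A]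
    [PartialOrder B] [BinOp B] [DcpoMeetSemilattice B] (e : A ≃o B)
    (he : ∀ a b, e (a ⋓ b) = e a ⋓ e b) : DcpoMeetSemilattice A where
  exists_isLUB D hD hD' := by
    obtain ⟨s, hs⟩ := IsDcpo.exists_isLUB _ (hD.image e)
      (directedOn_image_of_monotone hD' e.monotone)
    exact ⟨e.symm s, e.isLUB_image.1 hs⟩
  op_continuous := by
    have h : (fun p : A × A => p.1 ⋓ p.2) =
        fun p => e.symm ((fun q : B × B => q.1 ⋓ q.2) (e p.1, e p.2)) := by
      funext p
      exact (e.symm_apply_eq.2 (he p.1 p.2).symm).symm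
    rw [h]
    have hc := OrderIso.scottContinuous e
    exact ((ScottContinuous.prodMk (ScottContinuous.fst.comp hc)
      (ScottContinuous.snd.comp hc)).comp DcpoAlgebra.op_continuous).comp
      (OrderIso.scottContinuous e.symm)
  op_isGLB a b := by
    have h := DcpoMeetSemilattice.op_isGLB (e a) (e b)
    rw [← he] at h
    rw [← e.isGLB_image', Set.image_pair]
    exact h

/-- Precomposition with an order isomorphism. -/
def ScottMap.precompIso {X : Type*} {Y : Type*} (Z : Type*) [PartialOrder X] [PartialOrder Y]
    [PartialOrder Z] (e : X ≃o Y) : ScottMap Y Z ≃o ScottMap X Z where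
  toFun f := ⟨fun x => f (e x), (OrderIso.scottContinuous e).comp f.continuous⟩
  invFun f := ⟨fun y => f (e.symm y), (OrderIso.scottContinuous e.symm).comp f.continuous⟩
  left_inv f := ScottMap.ext (funext fun y => congrArg f (e.apply_symm_apply y))
  right_inv f := ScottMap.ext (funext fun x => congrArg f (e.symm_apply_apply x))
  map_rel_iff' {f g} := ⟨fun h y => by simpa using h (e.symm y), fun h x => h (e x)⟩

/-- The preimage of a subalgebra under a homomorphism. -/
def SubAlg.comap {A : Type*} {B : Type*} [PartialOrder A] [BinOp A] [PartialOrder B] [BinOp B]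
    (g : Hom A B) (T : SubAlg B) : SubAlg A where
  carrier := {a | g a ∈ T}
  op_mem a ha b hb := by
    change g (a ⋓ b) ∈ T
    rw [g.map_op]
    exact T.op_mem _ ha _ hb
  sup_mem D hD hD1 hD2 s hs :=
    T.sup_mem (g.toFun '' D) (by rintro _ ⟨d, hd, rfl⟩; exact hD hd) (hD1.image _)
      (directedOn_image_of_monotone hD2 g.continuous.monotone) _ (g.continuous hD1 hD2 hs)

/-- Restriction of an order isomorphism to corresponding subalgebras. -/
def SubAlg.isoOfMemIff {A : Type*} {B : Type*} [PartialOrder A] [BinOp A] [PartialOrder B]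
    [BinOp B] {S : SubAlg A} {T : SubAlg B} (e : A ≃o B) (h : ∀ a, a ∈ S ↔ e a ∈ T) : S ≃o T where
  toFun a := ⟨e a.1, (h a.1).1 a.2⟩
  invFun b := ⟨e.symm b.1, (h _).2 (by rw [e.apply_symm_apply]; exact b.2)⟩
  left_inv a := Subtype.ext (e.symm_apply_apply a.1)
  right_inv b := Subtype.ext (e.apply_symm_apply b.1)
  map_rel_iff' {a b} := e.le_iff_le (x := a.1) (y := b.1)

end Iso

/-! ### Completeness -/

/-- The homomorphic extension of a Scott-continuous map to the free dcpo-algebra. -/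
def freeHom {Y : Type u} {A : Type v} [PartialOrder Y] [PartialOrder A] [BinOp A] [DcpoAlgebra A]
    (f : ScottMap Y A) : Hom (FreeMagma Y) A :=
  ⟨freeLift f, freeLift_continuous f.continuous, fun _ _ => rfl⟩

/-- The two restriction maps differ by the isomorphism `hom(F(Y), C) ≃o C ^ Y`, so one is invertible
exactly when the other is. -/
theorem equable_freeHom_iff {Y : Type u} {A : Type v} [PartialOrder Y] [PartialOrder A] [BinOp A]
    [DcpoAlgebra A] {C : Type w} [PartialOrder C] [BinOp C] [DcpoAlgebra C] (e : ScottMap Y A) :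
    Equable C (freeHom e) ↔ EquableMap C e := by
  obtain ⟨ψ, hψ⟩ := equableMap_freeOf (X := Y) (A := C)
  constructor
  · rintro ⟨φ, hφ⟩
    refine ⟨φ.trans ψ, fun h y => ?_⟩
    change ψ (φ h) y = _
    rw [hψ, hφ]
    rfl
  · rintro ⟨φ, hφ⟩
    refine ⟨φ.trans ψ.symm, fun h t => ?_⟩
    have : ψ.symm (φ h) = h.comp (freeHom e) := by
      rw [ψ.symm_apply_eq]
      refine ScottMap.ext (funext fun y => ?_)
      rw [hψ, hφ]
      rfl
    change ψ.symm (φ h) t = _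
    rw [this]
    rfl

theorem IsComplete.isWeaklyComplete {R : Type v} [PartialOrder R] [BinOp R] [DcpoAlgebra R]
    {C : Type w} [PartialOrder C] [BinOp C] [DcpoAlgebra C] (h : IsComplete R C) :
    IsWeaklyComplete R C := fun _ _ _ _ _ _ _ e he =>
  (equable_freeHom_iff e).1 (h _ _ (freeHom e) ((equable_freeHom_iff e).2 he))

/-! ### The semilattice of open filters and its completeness -/

section HomZeroOne

variable {X : Type u} [PartialOrder X]

instance : DcpoMeetSemilattice (homZeroOne X) where
  op_isGLB φ ψ := by
    constructor
    · rintro c (rfl | rfl) f h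
      exacts [h.1, h.2]
    · intro c hc f h
      exact ⟨hc (Set.mem_insert _ _) f h, hc (Set.mem_insert_of_mem _ rfl) f h⟩

theorem homZeroOne.isLUB_apply {D : Set (homZeroOne X)} (hD : D.Nonempty)
    (hD' : DirectedOn (· ≤ ·) D) {s : homZeroOne X} (hs : IsLUB D s) (f : ScottMap X Sierp) :
    s.1 f ↔ ∃ φ ∈ D, φ.1 f := by
  constructor
  · intro h
    obtain ⟨_, ⟨φ, hφ, rfl⟩, h'⟩ := ScottMap.exists_mem_of_isLUB (hD.image _)
      (directedOn_image_of_monotone hD' (f := (Subtype.val : homZeroOne X → _)) fun _ _ h => h)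
      (SubAlg.isLUB_val hD hD' hs) h
    exact ⟨φ, hφ, h'⟩
  · rintro ⟨φ, hφ, h⟩
    exact hs.1 hφ f h

/-- Evaluation at a Scott-open set is a homomorphism into the two-element chain. -/
def homZeroOne.evalAt (f : ScottMap X Sierp) : Hom (homZeroOne X) Sierp :=
  ⟨fun φ => φ.1 f, scottContinuous_sierp (fun _ _ h => h f)
    (fun _ hD hD' _ hs => (homZeroOne.isLUB_apply hD hD' hs f).1), fun _ _ => rfl⟩

/-- Every Scott-continuous family of homomorphisms `h f : B → Σ` indexed by `f : Σ ^ X` and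
preserving binary meets, bottom and top in `f`, is given by a homomorphism
`B → hom_{0,1}(Σ ^ X, Σ)`. -/
def homZeroOne.lift {B : Type v} [PartialOrder B] [BinOp B] (h : ScottMap X Sierp → Hom B Sierp)
    (hc : ∀ b, ScottContinuous fun f => h f b) (hop : ∀ f g b, h (f ⋓ g) b = (h f b ⋓ h g b))
    (h0 : ∀ b, h (constMap X False) b = False) (h1 : ∀ b, h (constMap X True) b = True) :
    Hom B (homZeroOne X) where
  toFun b := ⟨⟨fun f => h f b, hc b⟩, fun f g => hop f g b, h0 b, h1 b⟩
  continuous := by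
    intro D hD hD' a ha
    refine SubAlg.isLUB_of_val (ScottMap.isLUB_of_pointwise fun f => ?_)
    rw [Set.image_image, Set.image_image]
    exact (h f).continuous hD hD' ha
  map_op a b := Subtype.ext (ScottMap.ext (funext fun f => (h f).map_op a b))

/-- A homomorphism into the algebra is extended one open set at a time. The conditions making the
extended family a filter hold on the image of `e`, and equability propagates them to all of `B`. -/
theorem isComplete_homZeroOne : IsComplete Sierp (homZeroOne X) := by
  intro A B _ _ _ _ _ _ e ⟨φ, hφ⟩
  -- Restriction along `e` reflects order, so inequalities between homomorphisms into `Σ` can be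
  -- tested on the image of `e`.
  have le_ext : ∀ h k : Hom B Sierp, (∀ a, h (e a) → k (e a)) → h ≤ k := fun h k hk =>
    φ.le_iff_le.1 fun a => by rw [hφ, hφ]; exact hk a
  have ext : ∀ h k : Hom B Sierp, (∀ a, h (e a) = k (e a)) → h = k := fun h k hk =>
    le_antisymm (le_ext h k fun a => (hk a).le) (le_ext k h fun a => (hk a).ge)
  let E (g : Hom A (homZeroOne X)) (f : ScottMap X Sierp) : Hom B Sierp :=
    φ.symm ((homZeroOne.evalAt f).comp g)
  have hE : ∀ g f a, E g f (e a) = (g a).1 f := fun g f a => by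
    rw [← hφ]
    exact congrArg (fun h : Hom A Sierp => h a) (φ.apply_symm_apply _)
  have hEc : ∀ g b, ScottContinuous fun f => E g f b := by
    intro g b D hD hD' f hf
    have hm : Monotone fun f => E g f := fun f₁ f₂ h =>
      φ.symm.monotone fun a => (g a).1.continuous.monotone h
    -- Suprema are computed in `hom(A, Σ)`, where continuity of each filter `g a` applies, and
    -- carried to `hom(B, Σ)` by the order isomorphism `φ.symm`.
    have hl : IsLUB ((fun f => E g f) '' D) (E g f) := by
      rw [← Set.image_image φ.symm (fun f => (homZeroOne.evalAt f).comp g)]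
      refine φ.symm.isLUB_image'.2 ⟨?_, ?_⟩
      · rintro _ ⟨d, hd, rfl⟩ a
        exact (g a).1.continuous.monotone (hf.1 hd)
      · intro h hh a ha
        obtain ⟨d, hd, hda⟩ := (g a).1.exists_apply_of_isLUB hD hD' hf ha
        exact hh ⟨d, hd, rfl⟩ a hda
    have := Hom.pointwise_of_isLUB (hD.image _) (directedOn_image_of_monotone hD' hm) hl b
    rwa [Set.image_image] at this
  let L (g : Hom A (homZeroOne X)) : Hom B (homZeroOne X) := homZeroOne.lift (E g) (hEc g)
    (fun f f' b => by
      -- Pointwise meet is a homomorphism because conjunction is associative and commutative; this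
      -- is where the choice of operation on `Σ` enters.
      let k : Hom B Sierp := ⟨fun b => E g f b ∧ E g f' b,
        ((E g f).continuous.prodMk (E g f').continuous).comp
          (DcpoAlgebra.op_continuous (A := Sierp)), fun a b => by
        rw [(E g f).map_op, (E g f').map_op]
        exact propext and_and_and_comm⟩
      refine congrArg (fun h : Hom B Sierp => h b) (ext (E g (f ⋓ f')) k fun a => ?_)
      change _ = (E g f (e a) ∧ E g f' (e a))
      rw [hE, hE, hE]
      exact (g a).2.1 f f')
    (fun b => by
      -- Constants are homomorphisms because conjunction is idempotent.
      let k : Hom B Sierp := ⟨fun _ => False, ScottContinuous.const _, fun _ _ =>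
        (propext (and_self_iff (a := False))).symm⟩
      refine congrArg (fun h : Hom B Sierp => h b) (ext (E g _) k fun a => ?_)
      rw [hE]
      exact (g a).2.2.1)
    (fun b => by
      let k : Hom B Sierp := ⟨fun _ => True, ScottContinuous.const _, fun _ _ =>
        (propext (and_self_iff (a := True))).symm⟩
      refine congrArg (fun h : Hom B Sierp => h b) (ext (E g _) k fun a => ?_)
      rw [hE]
      exact (g a).2.2.2)
  have key : ∀ h k : Hom B (homZeroOne X), (∀ a, h (e a) ≤ k (e a)) → h ≤ k := fun h k hk b f =>
    le_ext ((homZeroOne.evalAt f).comp h) ((homZeroOne.evalAt f).comp k) (fun a => hk a f) b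
  have hL : ∀ g a, L g (e a) = g a := fun g a =>
    Subtype.ext (ScottMap.ext (funext fun f => hE g f a))
  exact ⟨{ toFun := fun h => h.comp e
           invFun := L
           left_inv := fun h => le_antisymm (key _ _ fun a => (hL (h.comp e) a).le)
             (key _ _ fun a => (hL (h.comp e) a).ge)
           right_inv := fun g => Hom.ext (funext (hL g))
           map_rel_iff' := ⟨key _ _, fun h a => h (e a)⟩ }, fun _ _ => rfl⟩

end HomZeroOne

/-! ### Finite generation of `hom_{0,1}(Σ ^ X, Σ)` over a continuous dcpo -/

section Leaves

variable {X : Type u}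

/-- The set of leaves of a tree. -/
def leaves : FreeMagma X → Set X
  | .of x => {x}
  | .mul s t => leaves s ∪ leaves t

/-- In a meet-semilattice a tree evaluates to the meet of the values at its leaves, so trees stand
in for nonempty finite sets. -/
theorem le_freeLift_iff {B : Type v} [PartialOrder B] [BinOp B] [DcpoMeetSemilattice B] (f : X → B)
    (t : FreeMagma X) {b : B} : b ≤ freeLift f t ↔ ∀ x ∈ leaves t, b ≤ f x := by
  induction t using FreeMagma.rec with
  | of x => simp [freeLift, leaves]
  | mul s t hs ht =>
    change b ≤ freeLift f s ⋓ freeLift f t ↔ ∀ x ∈ leaves s ∪ leaves t, _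
    rw [le_isGLB_iff (DcpoMeetSemilattice.op_isGLB _ _)]
    simp [hs, ht, or_imp, forall_and]

end Leaves

/-! ### Approximation of open filters by finite meets of evaluations -/

section Approximation

variable {X : Type u} [PartialOrder X]

theorem WayBelow.le [IsContinuousDcpo X] {x y : X} (h : WayBelow x y) : x ≤ y :=
  (IsContinuousDcpo.isLUB_wayBelow y).1 h

theorem WayBelow.mono_right {x y z : X} (h : WayBelow x y) (hyz : y ≤ z) : WayBelow x z :=
  fun D hD hD' s hs hz => h D hD hD' s hs (hyz.trans hz)

/-- Interpolation: over a continuous dcpo, `{y | x ≪ y}` is Scott-open. -/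
theorem WayBelow.exists_mem_of_isLUB [IsContinuousDcpo X] {x a : X} (h : WayBelow x a)
    {D : Set X} (hD : D.Nonempty) (hD' : DirectedOn (· ≤ ·) D) (ha : IsLUB D a) :
    ∃ d ∈ D, WayBelow x d := by
  -- The elements way below some member of `D` form a directed set whose supremum is again `a`.
  obtain ⟨z, ⟨d, hd, hz⟩, hxz⟩ := h {z | ∃ d ∈ D, WayBelow z d}
    (by
      obtain ⟨d, hd⟩ := hD
      obtain ⟨z, hz⟩ := IsContinuousDcpo.nonempty_wayBelow d
      exact ⟨z, d, hd, hz⟩)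
    (by
      rintro z ⟨d, hd, hz⟩ z' ⟨d', hd', hz'⟩
      obtain ⟨c, hc, h1, h2⟩ := hD' d hd d' hd'
      obtain ⟨w, hw, h3, h4⟩ := IsContinuousDcpo.directedOn_wayBelow c z (hz.mono_right h1)
        z' (hz'.mono_right h2)
      exact ⟨w, ⟨c, hc, hw⟩, h3, h4⟩)
    a
    ⟨fun z ⟨d, hd, hz⟩ => hz.le.trans (ha.1 hd), fun b hb => ha.2 fun d hd =>
      (IsContinuousDcpo.isLUB_wayBelow d).2 fun z hz => hb ⟨d, hd, hz⟩⟩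
    le_rfl
  exact ⟨d, hd, fun E hE hE' s hs hds =>
    (hz E hE hE' s hs hds).imp fun _ h => ⟨h.1, hxz.trans h.2⟩⟩

theorem ScottMap.exists_wayBelow [IsContinuousDcpo X] (f : ScottMap X Sierp) {x : X} (h : f x) :
    ∃ y, WayBelow y x ∧ f y :=
  f.exists_apply_of_isLUB (IsContinuousDcpo.nonempty_wayBelow x)
    (IsContinuousDcpo.directedOn_wayBelow x) (IsContinuousDcpo.isLUB_wayBelow x) h

/-- The hypothesis is the Smyth preorder on finite leaf sets. -/
theorem freeLift_mono_of_leaves {B : Type v} [PartialOrder B] [BinOp B] [DcpoMeetSemilattice B]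
    {f : X → B} (hf : Monotone f) {s t : FreeMagma X}
    (h : ∀ y ∈ leaves t, ∃ x ∈ leaves s, x ≤ y) : freeLift f s ≤ freeLift f t := by
  refine (le_freeLift_iff f t).2 fun y hy => ?_
  obtain ⟨x, hx, hxy⟩ := h y hy
  exact ((le_freeLift_iff f s).1 le_rfl x hx).trans (hf hxy)

theorem freeLift_homZeroOneEval_apply (t : FreeMagma X) (u : ScottMap X Sierp) :
    (freeLift homZeroOneEval t).1 u ↔ ∀ x ∈ leaves t, u x := by
  induction t using FreeMagma.rec with
  | of x => simp [freeLift, leaves, homZeroOneEval, evalMap]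
  | mul s t hs ht =>
    change ((freeLift homZeroOneEval s).1 u ∧ (freeLift homZeroOneEval t).1 u) ↔
      ∀ x ∈ leaves s ∪ leaves t, u x
    simp [hs, ht, or_imp, forall_and]

theorem homZeroOneEval_continuous : ScottContinuous (homZeroOneEval : X → homZeroOne X) := by
  intro D hD hD' a ha
  constructor
  · rintro _ ⟨d, hd, rfl⟩ u hu
    exact u.apply_of_le (ha.1 hd) hu
  · intro ψ hψ u hu
    obtain ⟨d, hd, hud⟩ := u.exists_apply_of_isLUB hD hD' ha hu
    exact hψ ⟨d, hd, rfl⟩ u hud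

variable [IsContinuousDcpo X]

/-- The Scott-open set of all points that some leaf of the tree is way below. -/
def wayAbove (t : FreeMagma X) : ScottMap X Sierp :=
  ⟨fun y => ∃ x ∈ leaves t, WayBelow x y, scottContinuous_sierp
    (fun _ _ h ⟨x, hx, hxa⟩ => ⟨x, hx, hxa.mono_right h⟩)
    (fun _ hD hD' _ ha ⟨x, hx, hxa⟩ =>
      (hxa.exists_mem_of_isLUB hD hD' ha).imp fun _ hd => ⟨hd.1, x, hx, hd.2⟩)⟩

theorem wayAbove_mul_left (s t : FreeMagma X) : wayAbove s ≤ wayAbove (.mul s t) :=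
  fun _ ⟨x, hx, h⟩ => ⟨x, Or.inl hx, h⟩

theorem wayAbove_mul_right (s t : FreeMagma X) : wayAbove t ≤ wayAbove (.mul s t) :=
  fun _ ⟨x, hx, h⟩ => ⟨x, Or.inr hx, h⟩

/-- The sets `wayAbove t`, with all leaves of `t` in `u`, form a directed family with union `u`;
Scott-openness of the filter `φ` selects one of them. -/
theorem homZeroOne.exists_tree (φ : homZeroOne X) {u : ScottMap X Sierp} (hu : φ.1 u) :
    ∃ t, (∀ x ∈ leaves t, u x) ∧ φ.1 (wayAbove t) := by
  let D : Set (ScottMap X Sierp) := wayAbove '' {t | ∀ x ∈ leaves t, u x}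
  -- A tree has at least one leaf, so the family is nonempty only if `u` has a point; preservation
  -- of bottom provides it.
  have hpt : ∃ x, u x := by
    by_contra! hc
    have : u = constMap X False := ScottMap.ext (funext fun x => propext
      ⟨fun h => hc x h, False.elim⟩)
    rw [this, φ.2.2.1] at hu
    exact hu
  have hof : ∀ x, u x → FreeMagma.of x ∈ {t | ∀ x ∈ leaves t, u x} := by
    rintro x hx _ rfl
    exact hx
  have hD : D.Nonempty := by
    obtain ⟨x, hx⟩ := hpt
    exact ⟨_, _, hof x hx, rfl⟩
  have hD' : DirectedOn (· ≤ ·) D := by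
    rintro _ ⟨s, hs, rfl⟩ _ ⟨t, ht, rfl⟩
    exact ⟨_, ⟨.mul s t, fun x hx => hx.elim (hs x) (ht x), rfl⟩, wayAbove_mul_left s t,
      wayAbove_mul_right s t⟩
  have hl : IsLUB D u := by
    constructor
    · rintro _ ⟨t, ht, rfl⟩ y ⟨x, hx, hxy⟩
      exact u.apply_of_le hxy.le (ht x hx)
    · intro v hv y hy
      obtain ⟨x, hx, hux⟩ := u.exists_wayBelow hy
      exact hv ⟨_, hof x hux, rfl⟩ y ⟨x, rfl, hx⟩
  obtain ⟨_, ⟨t, ht, rfl⟩, h⟩ := φ.1.exists_apply_of_isLUB hD hD' hl hu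
  exact ⟨t, ht, h⟩

/-- Trees approximating an element of `hom_{0,1}(Σ ^ X, Σ)`. -/
def homZeroOne.trees (φ : homZeroOne X) : Set (FreeMagma X) := {t | φ.1 (wayAbove t)}

theorem homZeroOne.trees_nonempty (φ : homZeroOne X) : (homZeroOne.trees φ).Nonempty := by
  obtain ⟨t, -, ht⟩ := homZeroOne.exists_tree φ (u := constMap X True) (by
    rw [φ.2.2.2]
    trivial)
  exact ⟨t, ht⟩

theorem homZeroOne.exists_tree_above (φ : homZeroOne X) {s t : FreeMagma X} (hs : s ∈ (homZeroOne.trees φ))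
    (ht : t ∈ (homZeroOne.trees φ)) : ∃ r ∈ (homZeroOne.trees φ), (∀ y ∈ leaves r, ∃ x ∈ leaves s, x ≤ y) ∧
      ∀ y ∈ leaves r, ∃ x ∈ leaves t, x ≤ y := by
  -- The filter contains the intersection of the two sets, and a tree with leaves in that
  -- intersection refines both `s` and `t`.
  obtain ⟨r, hr, hr'⟩ := homZeroOne.exists_tree φ (u := wayAbove s ⋓ wayAbove t) (by
    rw [φ.2.1]
    exact ⟨hs, ht⟩)
  exact ⟨r, hr', fun y hy => (hr y hy).1.imp fun _ h => ⟨h.1, h.2.le⟩,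
    fun y hy => (hr y hy).2.imp fun _ h => ⟨h.1, h.2.le⟩⟩

theorem homZeroOne.directedOn_freeLift (φ : homZeroOne X) {B : Type v} [PartialOrder B] [BinOp B]
    [DcpoMeetSemilattice B] {f : X → B} (hf : Monotone f) :
    DirectedOn (· ≤ ·) (freeLift f '' (homZeroOne.trees φ)) := by
  rintro _ ⟨s, hs, rfl⟩ _ ⟨t, ht, rfl⟩
  obtain ⟨r, hr, h1, h2⟩ := homZeroOne.exists_tree_above φ hs ht
  exact ⟨_, ⟨r, hr, rfl⟩, freeLift_mono_of_leaves hf h1, freeLift_mono_of_leaves hf h2⟩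

/-- Evaluating a tree at the evaluations gives the filter of open sets containing all its leaves. If
`φ` contains `wayAbove t`, this filter lies inside `φ`, and by `homZeroOne.exists_tree` these
filters exhaust `φ`. -/
theorem homZeroOne.isLUB_freeLift (φ : homZeroOne X) :
    IsLUB (freeLift homZeroOneEval '' (homZeroOne.trees φ)) φ := by
  constructor
  · rintro _ ⟨t, ht, rfl⟩ u hu
    rw [freeLift_homZeroOneEval_apply] at hu
    have h : wayAbove t ≤ u := fun y ⟨x, hx, hxy⟩ => u.apply_of_le hxy.le (hu x hx)
    exact φ.1.apply_of_le h ht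
  · intro ψ hψ u hu
    obtain ⟨t, ht, ht'⟩ := homZeroOne.exists_tree φ hu
    exact hψ ⟨t, ht', rfl⟩ u ((freeLift_homZeroOneEval_apply t u).2 ht)

/-- Over a continuous dcpo, the evaluations generate `hom_{0,1}(Σ ^ X, Σ)`. -/
theorem homZeroOne.mem_of_eval_mem (T : SubAlg (homZeroOne X)) (hT : ∀ x, homZeroOneEval x ∈ T)
    (φ : homZeroOne X) : φ ∈ T := by
  refine T.sup_mem _ ?_ ((homZeroOne.trees_nonempty φ).image _)
    ((homZeroOne.directedOn_freeLift φ) homZeroOneEval_continuous.monotone) φ (homZeroOne.isLUB_freeLift φ)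
  rintro _ ⟨t, -, rfl⟩
  induction t using FreeMagma.rec with
  | of x => exact hT x
  | mul s t hs ht => exact T.op_mem _ hs _ ht

/-- The inclusion of a subalgebra. -/
def SubAlg.subtype {A : Type*} [PartialOrder A] [BinOp A] [IsDcpo A] (T : SubAlg A) : Hom T A :=
  ⟨Subtype.val, fun _ hD hD' _ hs => SubAlg.isLUB_val hD hD' hs, fun _ _ => rfl⟩

theorem homZeroOne_le (T : SubAlg (ScottMap (ScottMap X Sierp) Sierp))
    (hT : ∀ x, evalMap Sierp x ∈ T) : homZeroOne X ≤ T := fun φ hφ =>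
  homZeroOne.mem_of_eval_mem (T.comap (homZeroOne X).subtype) hT ⟨φ, hφ⟩

end Approximation

/-! ### Freeness -/

section Free

variable {X : Type u} [PartialOrder X] [IsContinuousDcpo X]

/-- The equalizer of two homomorphisms is a subalgebra, and the evaluations generate. -/
theorem homZeroOne.hom_ext {B : Type v} [PartialOrder B] [BinOp B] (g h : Hom (homZeroOne X) B)
    (hgh : ∀ x, g (homZeroOneEval x) = h (homZeroOneEval x)) : g = h := by
  let T : SubAlg (homZeroOne X) :=
    { carrier := {φ | g φ = h φ}
      op_mem := fun a ha b hb => by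
        change g (a ⋓ b) = h (a ⋓ b)
        rw [g.map_op, h.map_op, ha, hb]
      sup_mem := fun D hD hD1 hD2 s hs => by
        refine (g.continuous hD1 hD2 hs).unique ?_
        rw [Set.image_congr hD]
        exact h.continuous hD1 hD2 hs }
  exact Hom.ext (funext fun φ => homZeroOne.mem_of_eval_mem T hgh φ)

/-- `homZeroOne.isLUB_freeLift` dictates the value at `φ`: the supremum of `freeLift f t` over the
trees approximating `φ`. It is continuous in `φ` because the trees of a directed supremum are the
union of the trees of its members. -/
theorem homZeroOne.exists_extension {B : Type v} [PartialOrder B] [BinOp B]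
    [DcpoMeetSemilattice B] (f : ScottMap X B) :
    ∃ g : Hom (homZeroOne X) B, ∀ x, g (homZeroOneEval x) = f x := by
  have hm : Monotone f.toFun := f.continuous.monotone
  have hex : ∀ φ : homZeroOne X, ∃ b, IsLUB (freeLift f.toFun '' (homZeroOne.trees φ)) b := fun φ =>
    IsDcpo.exists_isLUB _ ((homZeroOne.trees_nonempty φ).image _) ((homZeroOne.directedOn_freeLift φ) hm)
  choose g hg using hex
  have hgm : ∀ φ ψ, φ ≤ ψ → g φ ≤ g ψ := fun φ ψ h => by
    refine (hg φ).2 ?_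
    rintro _ ⟨t, ht, rfl⟩
    exact (hg ψ).1 ⟨t, h _ ht, rfl⟩
  have hgc : ScottContinuous g := by
    intro D hD hD' a ha
    constructor
    · rintro _ ⟨d, hd, rfl⟩
      exact hgm d a (ha.1 hd)
    · intro b hb
      refine (hg a).2 ?_
      rintro _ ⟨t, ht, rfl⟩
      obtain ⟨d, hd, hdt⟩ := (homZeroOne.isLUB_apply hD hD' ha _).1 ht
      exact ((hg d).1 ⟨t, hdt, rfl⟩).trans (hb ⟨d, hd, rfl⟩)
  refine ⟨⟨g, hgc, fun φ ψ => le_antisymm ?_ ?_⟩, fun x => le_antisymm ?_ ?_⟩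
  · exact (le_isGLB_iff (DcpoMeetSemilattice.op_isGLB _ _)).2 (by
      rintro _ (rfl | rfl)
      · exact hgm _ _ fun _ h => h.1
      · exact hgm _ _ fun _ h => h.2)
  -- By joint continuity the meet of the two suprema is the supremum of the meets `freeLift f s ⋓
  -- freeLift f t`, and each of these is the value of the tree `.mul s t`, which approximates `φ ⋓
  -- ψ`.
  · have hlub : IsLUB ((freeLift f.toFun '' (homZeroOne.trees φ)) ×ˢ (freeLift f.toFun '' (homZeroOne.trees ψ)))
        (g φ, g ψ) := by
      have hφ := (homZeroOne.trees_nonempty φ).image (freeLift f.toFun)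
      have hψ := (homZeroOne.trees_nonempty ψ).image (freeLift f.toFun)
      rw [isLUB_prod, Set.fst_image_prod _ hψ, Set.snd_image_prod hφ]
      exact ⟨hg φ, hg ψ⟩
    refine (DcpoAlgebra.op_continuous (A := B)
      (((homZeroOne.trees_nonempty φ).image _).prod ((homZeroOne.trees_nonempty ψ).image _)) ?_ hlub).2 ?_
    · rintro ⟨a, b⟩ ⟨ha, hb⟩ ⟨a', b'⟩ ⟨ha', hb'⟩
      obtain ⟨c, hc, h1, h2⟩ := (homZeroOne.directedOn_freeLift φ) hm a ha a' ha'
      obtain ⟨d, hd, h3, h4⟩ := (homZeroOne.directedOn_freeLift ψ) hm b hb b' hb'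
      exact ⟨(c, d), ⟨hc, hd⟩, ⟨h1, h3⟩, h2, h4⟩
    · rintro _ ⟨⟨_, _⟩, ⟨⟨s, hs, rfl⟩, t, ht, rfl⟩, rfl⟩
      exact (hg _).1 ⟨.mul s t, ⟨φ.1.apply_of_le (wayAbove_mul_left s t) hs,
        ψ.1.apply_of_le (wayAbove_mul_right s t) ht⟩, rfl⟩
  -- A tree approximating the evaluation at `x` has a leaf way below `x`. Conversely, every `y ≪ x`
  -- is such a tree with one leaf, which gives the other inequality.
  · refine (hg _).2 ?_
    rintro _ ⟨t, ⟨y, hy, hyx⟩, rfl⟩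
    exact ((le_freeLift_iff f.toFun t).1 le_rfl y hy).trans (hm hyx.le)
  · refine (f.continuous (IsContinuousDcpo.nonempty_wayBelow x)
      (IsContinuousDcpo.directedOn_wayBelow x) (IsContinuousDcpo.isLUB_wayBelow x)).2 ?_
    rintro _ ⟨y, hy, rfl⟩
    exact (hg _).1 ⟨.of y, ⟨y, rfl, hy⟩, rfl⟩

theorem isFreeDcpoMeetSemilattice_homZeroOneEval :
    IsFreeDcpoMeetSemilattice (homZeroOneEval : X → homZeroOne X) where
  semilattice := inferInstance
  continuous := homZeroOneEval_continuous
  exists_unique_extension B _ _ _ f := by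
    obtain ⟨g, hg⟩ := homZeroOne.exists_extension f
    exact ⟨g, hg, fun h hh => homZeroOne.hom_ext h g fun x => (hh x).trans (hg x).symm⟩

theorem IsFreeDcpoMeetSemilattice.of_iso {X F G : Type u} [PartialOrder X] [PartialOrder F]
    [BinOp F] [PartialOrder G] [BinOp G] {ι : X → F} (h : IsFreeDcpoMeetSemilattice ι) (e : F ≃o G)
    (he : ∀ a b, e (a ⋓ b) = e a ⋓ e b) : IsFreeDcpoMeetSemilattice fun x => e (ι x) where
  semilattice :=
    have := h.semilattice
    DcpoMeetSemilattice.of_iso e.symm (symm_map_op he)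
  continuous := h.continuous.comp (OrderIso.scottContinuous e)
  exists_unique_extension B _ _ _ f := by
    obtain ⟨g, hg, hu⟩ := h.exists_unique_extension B f
    refine ⟨g.comp (Hom.ofIso e.symm (symm_map_op he)), fun x => ?_, fun k hk => ?_⟩
    · exact (congrArg g (e.symm_apply_apply (ι x))).trans (hg x)
    · rw [← hu (k.comp (Hom.ofIso e he)) hk]
      exact Hom.ext (funext fun y => congrArg k (e.apply_symm_apply y).symm)

end Free

/-! ### The repletion -/

section Repletion

variable (X : Type u) [PartialOrder X] [IsContinuousDcpo X]

/-- The isomorphism `hom(F(X), Σ) ≃o Σ ^ X` induces one between the ambient powers. The image of the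
filter algebra is complete and contains all evaluations, so it contains the repletion; being
generated by the evaluations at points of `X`, it is also contained in it. -/
theorem exists_iso_homZeroOne_dcpoRepletion :
    ∃ e : homZeroOne X ≃o dcpoRepletion Sierp X, (∀ φ ψ, e (φ ⋓ ψ) = e φ ⋓ e ψ) ∧
      ∀ x : X, e (homZeroOneEval x) = dcpoReflectionMap Sierp x := by
  obtain ⟨ρ, hρ⟩ := equableMap_freeOf (X := X) (A := Sierp)
  let Θ := ScottMap.precompIso Sierp ρ
  have hΘ : ∀ a b, Θ (a ⋓ b) = Θ a ⋓ Θ b := fun _ _ => rfl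
  have hΘx : ∀ x, Θ (evalMap Sierp x) = evalHom Sierp (freeOf x) := fun x =>
    ScottMap.ext (funext fun h => hρ h x)
  let H := (homZeroOne X).comap (Hom.ofIso Θ.symm (symm_map_op hΘ))
  have hH : ∀ a, a ∈ homZeroOne X ↔ Θ a ∈ H := fun a => by
    change _ ↔ Θ.symm (Θ a) ∈ homZeroOne X
    rw [Θ.symm_apply_apply]
  have hHc : IsComplete Sierp H :=
    isComplete_homZeroOne.of_iso (SubAlg.isoOfMemIff Θ hH) fun _ _ => rfl
  have hHe : ∀ t, evalHom Sierp t ∈ H := by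
    intro t
    induction t using FreeMagma.rec with
    | of x =>
      have := (hH _).1 (homZeroOneEval x).2
      change Θ (evalMap Sierp x) ∈ H at this
      rw [hΘx] at this
      exact this
    | mul s t hs ht =>
      have : evalHom Sierp (FreeMagma.mul s t) = evalHom Sierp s ⋓ evalHom Sierp t :=
        ScottMap.ext (funext fun h => h.map_op s t)
      change evalHom Sierp (FreeMagma.mul s t) ∈ H
      rw [this]
      exact H.op_mem _ hs _ ht
  have hmem : ∀ a, a ∈ homZeroOne X ↔ Θ a ∈ dcpoRepletion Sierp X := fun a =>
    ⟨fun ha T _ hT => homZeroOne_le (T.comap (Hom.ofIso Θ hΘ)) (fun x => by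
      change Θ _ ∈ T
      rw [hΘx]
      exact hT _) ha, fun ha => (hH a).2 (ha H hHc hHe)⟩
  exact ⟨SubAlg.isoOfMemIff Θ hmem, fun _ _ => rfl, fun x => Subtype.ext (hΘx x)⟩

end Repletion

/-! ### The Smyth powerdomain -/

section SmythIso

variable {X : Type u} [PartialOrder X]

/-- A nonempty compact saturated set, as a filter of Scott-open sets. -/
def Smyth.toHomZeroOne [IsDcpo X] (Q : Smyth X) : homZeroOne X :=
  ⟨⟨fun f => ∀ x ∈ Q.carrier, f x, scottContinuous_sierp (fun _ _ h hf x hx => h x (hf x hx)) <| by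
    intro D hD hD' f hf h
    let _ := scottTop X
    have := hD.to_subtype
    -- Compactness of `Q` is precisely Scott-openness of its filter of open neighbourhoods.
    obtain ⟨d, hd⟩ := Q.compact.elim_directed_cover (fun d : D => {x | d.1 x})
      (fun d => d.1.isOpen_setOf)
      (fun x hx => by
        obtain ⟨d, hd, hdx⟩ := ScottMap.exists_mem_of_isLUB hD hD' hf (h x hx)
        exact Set.mem_iUnion.2 ⟨⟨d, hd⟩, hdx⟩)
      (fun c d => by
        obtain ⟨e, he, h1, h2⟩ := hD' c.1 c.2 d.1 d.2
        exact ⟨⟨e, he⟩, fun x hx => h1 x hx, fun x hx => h2 x hx⟩)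
    exact ⟨d.1, d.2, hd⟩⟩,
    fun f g => propext ⟨fun h => ⟨fun x hx => (h x hx).1, fun x hx => (h x hx).2⟩,
      fun h x hx => ⟨h.1 x hx, h.2 x hx⟩⟩,
    propext ⟨fun h => Q.nonempty.elim h, False.elim⟩,
    propext ⟨fun _ => trivial, fun _ _ _ => trivial⟩⟩

/-- A saturated set is recovered as the intersection of its open neighbourhoods. -/
theorem Smyth.toHomZeroOne_le_iff [IsDcpo X] {P Q : Smyth X} :
    P.toHomZeroOne ≤ Q.toHomZeroOne ↔ P ≤ Q := by
  refine ⟨fun h x hx => ?_, fun h f hf x hx => hf x (h hx)⟩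
  change x ∈ P.carrier
  rw [P.saturated]
  rintro U ⟨hU, hPU⟩
  exact h (openMap U hU) hPU x hx

variable [IsContinuousDcpo X]

/-- The Hofmann–Mislove property of continuous dcpos: a Scott-open filter of Scott-open sets
contains every Scott-open set that contains its intersection. -/
theorem homZeroOne.apply_of_forall (φ : homZeroOne X) (f : ScottMap X Sierp)
    (hf : ∀ x, (∀ g, φ.1 g → g x) → f x) : φ.1 f := by
  by_contra hφf
  -- Scott-openness of the filter keeps unions of chains outside it, so `f` extends to a maximal
  -- open set `m` outside it. The aim is to show that the complement of `m` has a greatest element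
  -- `x`, which lies in every member of the filter but not in `f`.
  obtain ⟨m, hfm, hm⟩ := zorn_le_nonempty₀ {g : ScottMap X Sierp | ¬ φ.1 g} (by
    intro c hc hchain g hg
    refine ⟨supMap c, fun h => ?_, (isLUB_supMap c).1⟩
    obtain ⟨d, hd, hd'⟩ := φ.1.exists_apply_of_isLUB ⟨g, hg⟩ hchain.directedOn (isLUB_supMap c) h
    exact hc hd hd') f hφf
  have hmφ : ¬ φ.1 m := hm.prop
  have hmax : ∀ g, ¬ g ≤ m → φ.1 (supMap {m, g}) := by
    intro g hg
    by_contra hc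
    have h := (isLUB_supMap {m, g}).1
    exact hg ((h (Set.mem_insert_of_mem _ rfl)).trans
      (hm.le_of_ge hc (h (Set.mem_insert _ _))))
  have hof : ∀ {y p}, WayBelow y p → ¬ m p → ¬ wayAbove (.of y) ≤ m := fun hy hp h =>
    hp (h _ ⟨_, rfl, hy⟩)
  -- The supremum of `E` will be `x`: every point outside `m` is a supremum of elements of `E`.
  let E : Set X := {y | ∃ p, WayBelow y p ∧ ¬ m p}
  have hE : E.Nonempty := by
    by_contra hc
    refine hmφ ?_
    have : m = constMap X True := ScottMap.ext (funext fun x => propext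
      ⟨fun _ => trivial, fun _ => by
        by_contra hx
        obtain ⟨y, hy⟩ := IsContinuousDcpo.nonempty_wayBelow x
        exact hc ⟨y, x, hy, hx⟩⟩)
    rw [this, φ.2.2.2]
    trivial
  have hE' : DirectedOn (· ≤ ·) E := by
    rintro y ⟨p, hy, hp⟩ z ⟨q, hz, hq⟩
    -- By maximality both unions belong to the filter, hence so does their intersection. It is
    -- therefore not contained in `m`, and any of its points outside `m` has both `y` and `z` way
    -- below it.
    have h : φ.1 (supMap {m, wayAbove (.of y)} ⋓ supMap {m, wayAbove (.of z)}) := by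
      rw [φ.2.1]
      exact ⟨hmax _ (hof hy hp), hmax _ (hof hz hq)⟩
    obtain ⟨r, ⟨hr1, hr2⟩, hr⟩ : ∃ r, (supMap {m, wayAbove (.of y)} ⋓
        supMap {m, wayAbove (.of z)}) r ∧ ¬ m r := by
      by_contra! hc
      exact hmφ (φ.1.apply_of_le hc h)
    have aux : ∀ {y}, supMap {m, wayAbove (.of y)} r → WayBelow y r := by
      rintro y ⟨_, rfl | rfl, hgr⟩
      · exact absurd hgr hr
      · obtain ⟨_, rfl, hyr⟩ := hgr
        exact hyr
    obtain ⟨w, hw, h1, h2⟩ := IsContinuousDcpo.directedOn_wayBelow r y (aux hr1) z (aux hr2)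
    exact ⟨w, ⟨r, hw, hr⟩, h1, h2⟩
  obtain ⟨x, hx⟩ := IsDcpo.exists_isLUB E hE hE'
  have hmx : ¬ m x := fun h => by
    obtain ⟨y, ⟨p, hyp, hp⟩, hy⟩ := m.exists_apply_of_isLUB hE hE' hx h
    exact hp (m.apply_of_le hyp.le hy)
  refine hmx (hfm x (hf x fun g hg => ?_))
  by_contra hgx
  -- If `g` missed `x` it would be contained in `m`, since each point `c` outside `m` satisfies `c ≤
  -- x`.
  refine hmφ (φ.1.apply_of_le (fun c hc => ?_) hg)
  by_contra hmc
  exact hgx (g.apply_of_le ((IsContinuousDcpo.isLUB_wayBelow c).2 fun y hy => hx.1 ⟨c, hy, hmc⟩) hc)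

/-- The intersection of a Scott-open filter of Scott-open sets. -/
def homZeroOne.toSmyth (φ : homZeroOne X) : Smyth X where
  carrier := {x | ∀ g, φ.1 g → g x}
  nonempty := by
    by_contra hc
    have h := (homZeroOne.apply_of_forall φ) (constMap X False) fun x hx => hc ⟨x, hx⟩
    rw [φ.2.2.1] at h
    exact h
  compact := by
    let _ := scottTop X
    refine isCompact_of_finite_subcover fun {ι} U hU hc => ?_
    -- The finite subunions are directed and their union contains the intersection of the filter.
    -- That union is thus in the filter by `homZeroOne.apply_of_forall`, and Scott-openness puts a
    -- finite subunion there too.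
    let V (t : Finset ι) : ScottMap X Sierp :=
      openMap (⋃ i ∈ t, U i) (isOpen_biUnion fun i _ => hU i)
    have hV : ∀ {s t : Finset ι}, s ⊆ t → V s ≤ V t := fun h x hx =>
      Set.biUnion_subset_biUnion_left (fun _ hi => h hi) hx
    obtain ⟨_, ⟨t, rfl⟩, ht⟩ := φ.1.exists_apply_of_isLUB (D := Set.range V) ⟨_, ∅, rfl⟩
      (by
        classical
        rintro _ ⟨s, rfl⟩ _ ⟨t, rfl⟩
        exact ⟨_, ⟨s ∪ t, rfl⟩, hV Finset.subset_union_left, hV Finset.subset_union_right⟩)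
      (isLUB_supMap _)
      ((homZeroOne.apply_of_forall φ) _ fun x hx => by
        obtain ⟨i, hi⟩ := Set.mem_iUnion.1 (hc hx)
        exact ⟨_, ⟨{i}, rfl⟩, Set.mem_biUnion (Finset.mem_coe.2 (Finset.mem_singleton_self i)) hi⟩)
    exact ⟨t, fun x hx => hx _ ht⟩
  saturated := Set.Subset.antisymm (fun _ hx _ hU => hU.2 hx) fun _ hx g hg =>
    hx {y | g y} ⟨g.isOpen_setOf, fun _ hy => hy g hg⟩

variable (X) in
/-- Nonempty compact saturated sets of a continuous dcpo correspond to Scott-open filters of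
Scott-open sets. -/
def smythIso : Smyth X ≃o homZeroOne X where
  toFun := Smyth.toHomZeroOne
  invFun := homZeroOne.toSmyth
  left_inv Q := Smyth.ext (by
    refine Set.Subset.antisymm (fun x hx => ?_) fun x hx g hg => hg x hx
    rw [Q.saturated]
    rintro U ⟨hU, hQU⟩
    exact hx (openMap U hU) hQU)
  right_inv φ := Subtype.ext (ScottMap.ext (funext fun f => propext
    ⟨(homZeroOne.apply_of_forall φ) f, fun hf _ hx => hx f hf⟩))
  map_rel_iff' := Smyth.toHomZeroOne_le_iff

theorem smythIso_op (P Q : Smyth X) : smythIso X (P ⋓ Q) = smythIso X P ⋓ smythIso X Q :=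
  Subtype.ext (ScottMap.ext (funext fun _ => propext
    ⟨fun h => ⟨fun x hx => h x (Or.inl hx), fun x hx => h x (Or.inr hx)⟩,
      fun h x hx => hx.elim (h.1 x) (h.2 x)⟩))

theorem smythIso_embed (x : X) : smythIso X (Smyth.embed x) = homZeroOneEval x :=
  Subtype.ext (ScottMap.ext (funext fun f => propext
    ⟨fun h => h x le_rfl, fun h _ hy => f.apply_of_le hy h⟩))

end SmythIso

end DomainRepletion

open DomainRepletion in
theorem theorem4p2 (X : Type u) [PartialOrder X] [IsContinuousDcpo X] :
    DcpoMeetSemilattice (homZeroOne X) ∧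
    IsLeast {T : SubAlg (ScottMap (ScottMap X Sierp) Sierp) |
      IsComplete Sierp T ∧ ∀ x : X, evalMap Sierp x ∈ T} (homZeroOne X) ∧
    IsLeast {T : SubAlg (ScottMap (ScottMap X Sierp) Sierp) |
      IsWeaklyComplete Sierp T ∧ ∀ x : X, evalMap Sierp x ∈ T} (homZeroOne X) ∧
    (∃ e : homZeroOne X ≃o dcpoRepletion Sierp X,
      (∀ φ ψ, e (φ ⋓ ψ) = e φ ⋓ e ψ) ∧
      ∀ x : X, e (homZeroOneEval x) = dcpoReflectionMap Sierp x) ∧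
    IsFreeDcpoMeetSemilattice (Smyth.embed : X → Smyth X) ∧
    (∃ e : Smyth X ≃o dcpoRepletion Sierp X,
      (∀ P Q, e (P ⋓ Q) = e P ⋓ e Q) ∧
      ∀ x : X, e (Smyth.embed x) = dcpoReflectionMap Sierp x) := by
  have heval : ∀ x : X, evalMap Sierp x ∈ homZeroOne X := fun x => (homZeroOneEval x).2
  obtain ⟨e, he, hex⟩ := exists_iso_homZeroOne_dcpoRepletion X
  refine ⟨inferInstance, ⟨⟨isComplete_homZeroOne, heval⟩, fun T hT => homZeroOne_le T hT.2⟩,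
    ⟨⟨isComplete_homZeroOne.isWeaklyComplete, heval⟩, fun T hT => homZeroOne_le T hT.2⟩,
    ⟨e, he, hex⟩, ?_, (smythIso X).trans e, fun P Q => ?_, fun x => ?_⟩
  · have h := isFreeDcpoMeetSemilattice_homZeroOneEval.of_iso (smythIso X).symm
      (symm_map_op (smythIso_op (X := X)))
    have hx : (fun x : X => (smythIso X).symm (homZeroOneEval x)) = Smyth.embed :=
      funext fun x => (smythIso X).symm_apply_eq.2 (smythIso_embed x).symm
    rwa [hx] at h
  · change e (smythIso X (P ⋓ Q)) = _
    rw [smythIso_op, he]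
    rfl
  · change e (smythIso X _) = _
    rw [smythIso_embed, hex]
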